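/- Let $l_1,l_2\ge 1$ be integers and, for $j=1,2$, let $\Gamma^{(j)}(x)=\sum_r\Gamma^{(j)}_r x^r$ be a finitely supported probability distribution on degrees $r\ge 0$ (real weights) with $\Gamma^{(j)}_r>0$ for some $r\ge 2$. Write $\Gamma^{(j)\prime}(1)=\sum_r r\Gamma^{(j)}_r$ and $R_{\rm des}=1-l_1/\Gamma^{(1)\prime}(1)-l_2/\Gamma^{(2)\prime}(1)$. **Ensemble.** A graph of block length $n$ in the left-regular two edge type LDPC ensemble $\{l_1,l_2,\Gamma^{(1)},\Gamma^{(2)}\}$ has $n$ variable nodes, each with $l_1$ edges of type one and $l_2$ edges of type two, and $M^{(j)}_r$ check nodes of type $j$ and degree $r$, where $\sum_r rM^{(j)}_r=nl_j$. For each type $j$ it is given by a bijection between the $nl_j$ variable-node sockets of type $j$ and the $nl_j$ check-node sockets of type $j$ (so multiple edges are allowed), and it is chosen uniformly among all such pairs of bijections. We consider any sequence of block lengths $n\to\infty$ and of counts $M^{(j)}_r=M^{(j)}_r(n)$ with $M^{(j)}_r/n\to l_j\Gamma^{(j)}_r/\Gamma^{(j)\prime}(1)$ for all $r$, and $M^{(j)}_r=0$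 if $\Gamma^{(j)}_r=0$; in particular $M^{(j)}_r=nl_j\Gamma^{(j)}_r/\Gamma^{(j)\prime}(1)$, along those $n$ for which these are integers. The code of a graph $G$ is the set of $x\in\mathbb F_2^n$ with $H_1x=0$ and $H_2x=0$, where the entries of $H_j$ are the numbers of type $j$ edges between check and variable nodes, modulo 2. Let $N$ be its number of codewords and $R_G=\frac1n\log_2N$ its rate. **The function $\theta$.** Let $h(e)=-e\log_2e-(1-e)\log_2(1-e)$, $q_r(v)=\frac{(1+v)^r+(1-v)^r}{2}$ and $$\epsilon_j=1-\frac{\sum_{r\text{ odd}}\Gamma^{(j)}_r}{\Gamma^{(j)\prime}(1)}\in(0,1].$$ For $0<e<\epsilon_j$ the equation $$\frac{v_j}{\Gamma^{(j)\prime}(1)}\sum_r r\,\Gamma^{(j)}_r\,\frac{(1+v_j)^{r-1}-(1-v_j)^{r-1}}{(1+v_j)^{r}+(1-v_j)^{r}}=e$$ has a unique positive solution $v_j=v_j(e)$, and the set $D$ of those $e\in(0,1)$ for which both equations ($j=1,2$) have a positive solution is the interval $(0,\min(\epsilon_1,\epsilon_2))$. (So $D=(0,1)$ when all check degrees are even.)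 For $e\in D$ define $$\theta(e)=(1-l_1-l_2)h(e)+\sum_{j=1}^{2}\frac{l_j}{\Gamma^{(j)\prime}(1)}\sum_r\Gamma^{(j)}_r\log_2q_r(v_j(e))-e\,l_1\log_2v_1(e)-e\,l_2\log_2v_2(e)-R_{\rm des}.$$ **Lemma.** The function $\theta$ is bounded above on $D\ne\emptyset$, and $$\lim_{n\to\infty}\frac{\log_2\mathbb E[N]}{n}=\sup_{e\in D}\theta(e)+R_{\rm des}.$$ If $\sup_{e\in D}\theta(e)=0$, then $\lim_{n\to\infty}\mathbb P(R_G>R_{\rm des}+\delta)=0$ for every $\delta>0$. If moreover $\Gamma^{(j)}_0=\Gamma^{(j)}_1=0$ for $j=1,2$ (all check degrees are at least 2), then $1/2\in D$, and the condition $\sup_{D}\theta=0$ is equivalent to $\theta(1/2)\ge\theta(e)$ for all $e\in D$. -/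

import Mathlib

open Filter Topology Set
open scoped Polynomial

namespace TwoEdgeLDPC

noncomputable section

/-! ### Graphs, codes and the uniform ensemble

`M : ℕ →₀ ℕ` records a collection of check nodes: `M r` is the number of check nodes of degree
`r`. -/

/-- The check nodes (of one type). -/
abbrev CheckNode (M : ℕ →₀ ℕ) : Type := Σ r : M.support, Fin (M r)

/-- The check node sockets (of one type): a check node of degree `r` has `r` sockets. -/
abbrev CheckSocket (M : ℕ →₀ ℕ) : Type := Σ c : CheckNode M, Fin (c.1 : ℕ)

/-- The variable node sockets of one type: each of the `n` variable nodes has `l` of them. -/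
abbrev VarSocket (n l : ℕ) : Type := Fin n × Fin l

/-- A left-regular two edge type bipartite multigraph with `n` variable nodes, each with `l₁`
edges of type one and `l₂` edges of type two, and with `M₁ r` (resp. `M₂ r`) check nodes of degree
`r` and type one (resp. two): for each type, a matching of the variable node sockets with the check
node sockets. Multiple edges between two nodes are allowed. -/
abbrev TannerGraph (n l₁ l₂ : ℕ) (M₁ M₂ : ℕ →₀ ℕ) : Type :=
  (VarSocket n l₁ ≃ CheckSocket M₁) × (VarSocket n l₂ ≃ CheckSocket M₂)

/-- The parity-check matrix over `𝔽₂` of the edges of one type: the entry at `(c, i)` is the number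
of edges between check node `c` and variable node `i`, modulo 2. -/
def parityMatrix {n l : ℕ} {M : ℕ →₀ ℕ} (σ : VarSocket n l ≃ CheckSocket M) :
    Matrix (CheckNode M) (Fin n) (ZMod 2) :=
  Matrix.of fun c i => ((Finset.univ.filter fun s : Fin l => (σ (i, s)).1 = c).card : ZMod 2)

variable {n l₁ l₂ : ℕ} {M₁ M₂ : ℕ →₀ ℕ}

/-- The code of a graph: the words `x` with `H₁ x = 0` and `H₂ x = 0`. -/
def codewords (G : TannerGraph n l₁ l₂ M₁ M₂) : Set (Fin n → ZMod 2) :=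
  {x | (parityMatrix G.1).mulVec x = 0 ∧ (parityMatrix G.2).mulVec x = 0}

/-- The number `N` of codewords. -/
def numCodewords (G : TannerGraph n l₁ l₂ M₁ M₂) : ℕ := (codewords G).ncard

/-- The actual rate `R_G = log₂ N / n`. -/
def rate (G : TannerGraph n l₁ l₂ M₁ M₂) : ℝ := Real.logb 2 (numCodewords G) / n

/-- `𝔼[N]`, for a uniformly random graph. -/
def expNumCodewords (n l₁ l₂ : ℕ) (M₁ M₂ : ℕ →₀ ℕ) : ℝ :=
  (∑ G : TannerGraph n l₁ l₂ M₁ M₂, (numCodewords G : ℝ)) /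
    Fintype.card (TannerGraph n l₁ l₂ M₁ M₂)

/-- `ℙ(R_G > t)`, for a uniformly random graph. -/
def probRateGT (n l₁ l₂ : ℕ) (M₁ M₂ : ℕ →₀ ℕ) (t : ℝ) : ℝ :=
  ({G : TannerGraph n l₁ l₂ M₁ M₂ | t < rate G}.ncard : ℝ) /
    Fintype.card (TannerGraph n l₁ l₂ M₁ M₂)

/-! ### Degree distributions -/

/-- `Γ(x) = ∑ r, Γ_r x ^ r` is a degree distribution from the node perspective. -/
structure IsDegreeDist (Γ : ℝ[X]) : Prop where
  nonneg : ∀ r, 0 ≤ Γ.coeff r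
  sum_eq_one : Γ.eval 1 = 1

/-- The average degree `Γ'(1)`. -/
def avgDegree (Γ : ℝ[X]) : ℝ := Γ.derivative.eval 1

/-- The check node counts `M k` (one edge type) of a sequence of left-regular graphs with `n k`
variable nodes of degree `l` follow the degree distribution `Γ`: the numbers of edges on both sides
agree, only degrees occurring in `Γ` occur, and the number of check nodes of degree `r`, divided by
`n k`, tends to `Γ_r l / Γ'(1)`. In particular this allows the counts to be equal to
`n k * (Γ_r l / Γ'(1))` for all `k`, if these numbers are integers. -/
structure FollowsDegreeDist (l : ℕ) (Γ : ℝ[X]) (n : ℕ → ℕ) (M : ℕ → ℕ →₀ ℕ) : Prop where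
  edges : ∀ k, ((M k).sum fun r m => r * m) = n k * l
  support : ∀ k, (M k).support ⊆ Γ.support
  tendsto : ∀ r, Tendsto (fun k => (M k r : ℝ) / n k) atTop (𝓝 (Γ.coeff r * l / avgDegree Γ))

/-- The design rate `1 - (m₁ + m₂) / n`, where `m_j = n l_j / Γ_j'(1)`. -/
def designRate (l₁ l₂ : ℕ) (Γ₁ Γ₂ : ℝ[X]) : ℝ :=
  1 - l₁ / avgDegree Γ₁ - l₂ / avgDegree Γ₂

/-! ### The function `θ` -/

/-- Binary entropy in bits. -/
def binEntropy₂ (x : ℝ) : ℝ := -x * Real.logb 2 x - (1 - x) * Real.logb 2 (1 - x)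

/-- `q_r(v) = ((1 + v) ^ r + (1 - v) ^ r) / 2`. -/
def q (r : ℕ) (v : ℝ) : ℝ := ((1 + v) ^ r + (1 - v) ^ r) / 2

/-- The left-hand side of the saddle point equation `saddle Γ v = e`. The summand with `r = 0`
vanishes because of the factor `r`. -/
def saddle (Γ : ℝ[X]) (v : ℝ) : ℝ :=
  v / avgDegree Γ * Γ.sum fun r g =>
    r * g * (((1 + v) ^ (r - 1) - (1 - v) ^ (r - 1)) / ((1 + v) ^ r + (1 - v) ^ r))

open Classical in
/-- The positive solution `v` of `saddle Γ v = e` (and `0` if there is none). -/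
def saddleRoot (Γ : ℝ[X]) (e : ℝ) : ℝ :=
  if h : ∃ v : ℝ, 0 < v ∧ saddle Γ v = e then h.choose else 0

/-- The set of those `e ∈ (0, 1)` for which both saddle point equations have a positive solution,
i.e. for which `θ(e)` is defined. -/
def thetaDomain (Γ₁ Γ₂ : ℝ[X]) : Set ℝ :=
  {e | e ∈ Ioo (0 : ℝ) 1 ∧ (∃ v : ℝ, 0 < v ∧ saddle Γ₁ v = e) ∧ ∃ v : ℝ, 0 < v ∧ saddle Γ₂ v = e}

/-- The function `θ`, on `thetaDomain Γ₁ Γ₂`. -/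
def theta (l₁ l₂ : ℕ) (Γ₁ Γ₂ : ℝ[X]) (e : ℝ) : ℝ :=
  (1 - l₁ - l₂) * binEntropy₂ e
    + l₁ / avgDegree Γ₁ * Γ₁.sum (fun r g => g * Real.logb 2 (q r (saddleRoot Γ₁ e)))
    + l₂ / avgDegree Γ₂ * Γ₂.sum (fun r g => g * Real.logb 2 (q r (saddleRoot Γ₂ e)))
    - e * l₁ * Real.logb 2 (saddleRoot Γ₁ e) - e * l₂ * Real.logb 2 (saddleRoot Γ₂ e)
    - designRate l₁ l₂ Γ₁ Γ₂

/-- `1 - (∑_{r odd} Γ_r) / Γ'(1)`: asymptotically, the largest fraction of edges that can carry the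
value one when every check node sees an even number of ones. -/
def maxFraction (Γ : ℝ[X]) : ℝ :=
  1 - (Γ.sum fun r g => if Odd r then g else 0) / avgDegree Γ

end

end TwoEdgeLDPC

open TwoEdgeLDPC

/-!
The expected number of codewords of weight `w` is `n.choose w` times the probabilities, one for each
edge type, that a uniformly random set of `w * l` check node sockets is even, i.e. meets every check
node in an even number of sockets. The even sets of `s` sockets are counted by the coefficient of
`x ^ s` in a product of the polynomials `q_r(x)`, one for each check node.

Since the coefficients are nonnegative, this number is at most the product at `v`, divided by
`v ^ s`, for every `v > 0`; the best `v` solves the saddle point equation. Conversely some size `s`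
contributes at least its average share of the product at `v`. Comparing the products at
`exp t`, for `t` near `log v`, shows that the relative size of such an `s` is close to `saddle Γ v`,
and the numbers of even sets of neighbouring even sizes differ by a bounded factor, so the saddle
point bound is sharp up to a subexponential factor for every even size with this limiting relative
size.

By compactness of the set of relative weights, it remains to bound the weights near the endpoints of
`D` and outside it. The bound for `e` outside `D` comes from letting `v` tend to infinity, and for
an endpoint from the monotonicity of the saddle point solutions. Finally Markov's inequality turns
the growth rate of the expectation into concentration of the rate.
-/

namespace TwoEdgeLDPC

open scoped Finset

/-! ### Uniformly random bijections -/

section Bijections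

variable {α β : Type*} [Fintype α] [Fintype β] [DecidableEq α] [DecidableEq β]

theorem card_equiv_map_eq_congr (X : Finset α) {T T' : Finset β} (h : #T = #T') :
    #{σ : α ≃ β | X.map σ.toEmbedding = T} = #{σ : α ≃ β | X.map σ.toEmbedding = T'} := by
  have := Set.powersetCard.isPretransitive (α := β) (n := #T')
  obtain ⟨π, hπ⟩ := MulAction.exists_smul_eq (Equiv.Perm β)
    (⟨T, h⟩ : Set.powersetCard β #T') ⟨T', rfl⟩
  have hTT' : T.map π.toEmbedding = T' := by
    rw [Finset.map_eq_image]
    exact congrArg Subtype.val hπ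
  refine Finset.card_equiv ((Equiv.refl α).equivCongr π) fun σ => ?_
  have hσ : X.map ((Equiv.refl α).equivCongr π σ).toEmbedding =
      (X.map σ.toEmbedding).map π.toEmbedding := by
    rw [Finset.map_map]
    rfl
  simp only [Finset.mem_filter, Finset.mem_univ, true_and, hσ, ← hTT', Finset.map_inj]

theorem card_equiv_filter_map (X : Finset α) (σ₀ : α ≃ β) (P : Finset β → Prop)
    [DecidablePred P] :
    #{σ : α ≃ β | P (X.map σ.toEmbedding)} =
      #{T : Finset β | #T = #X ∧ P T} *
        #{σ : α ≃ β | X.map σ.toEmbedding = X.map σ₀.toEmbedding} := by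
  rw [Finset.card_eq_sum_card_fiberwise (f := fun σ : α ≃ β => X.map σ.toEmbedding)
    (t := {T : Finset β | #T = #X ∧ P T}) (fun σ hσ => by simpa using hσ)]
  refine Finset.sum_const_nat fun T hT => ?_
  obtain ⟨hTX, hPT⟩ := (Finset.mem_filter.1 hT).2
  rw [← card_equiv_map_eq_congr X (T := T) (by rw [hTX, Finset.card_map]), Finset.filter_filter]
  congr 1
  refine Finset.filter_congr fun σ _ => and_iff_right_of_imp ?_
  rintro rfl
  exact hPT

theorem card_equiv_filter_mul_choose (hαβ : Fintype.card α = Fintype.card β) (X : Finset α)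
    (P : Finset β → Prop) [DecidablePred P] :
    #{σ : α ≃ β | P (X.map σ.toEmbedding)} * (Fintype.card α).choose #X =
      #{T : Finset β | #T = #X ∧ P T} * Fintype.card (α ≃ β) := by
  obtain ⟨σ₀⟩ : Nonempty (α ≃ β) := Fintype.card_eq.1 hαβ
  have htotal := card_equiv_filter_map X σ₀ fun _ => True
  have hchoose : #{T : Finset β | #T = #X} = (Fintype.card α).choose #X := by
    rw [hαβ, Finset.univ_filter_card_eq, Finset.card_powersetCard, Finset.card_univ]
  simp only [and_true, hchoose, Finset.filter_true, Finset.card_univ] at htotal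
  rw [card_equiv_filter_map X σ₀ P, htotal]
  ring

end Bijections

/-! ### Even sets of sockets and the expected number of codewords -/

section Ensemble

variable {n l l₁ l₂ : ℕ} {M M₁ M₂ : ℕ →₀ ℕ}

/-- A set of check node sockets is even if it contains an even number of sockets of every check
node, that is, if all checks are satisfied when exactly these sockets carry the value one. -/
def IsEvenSet (T : Finset (CheckSocket M)) : Prop :=
  ∀ c, Even #{y ∈ T | y.1 = c}

instance : DecidablePred (IsEvenSet (M := M)) := fun _ =>
  inferInstanceAs (Decidable (∀ _, _))

/-- The number of even sets of `s` check node sockets. -/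
def evenCount (M : ℕ →₀ ℕ) (s : ℕ) : ℕ :=
  #{T : Finset (CheckSocket M) | #T = s ∧ IsEvenSet T}

@[to_additive]
theorem prod_checkNode {R : Type*} [CommMonoid R] (M : ℕ →₀ ℕ) (f : ℕ → R) :
    ∏ c : CheckNode M, f c.1 = M.prod fun r m => f r ^ m := by
  simp only [Fintype.prod_sigma, Finset.prod_const, Finset.card_univ, Fintype.card_fin]
  exact Finset.prod_coe_sort M.support fun r => f r ^ M r

theorem card_checkSocket (M : ℕ →₀ ℕ) :
    Fintype.card (CheckSocket M) = M.sum fun r m => r * m := by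
  simp only [Fintype.card_sigma, Fintype.card_fin]
  rw [sum_checkNode M fun r => r]
  simp only [smul_eq_mul, mul_comm]

theorem card_varSocket (n l : ℕ) : Fintype.card (VarSocket n l) = n * l := by simp

/-- The variable node sockets that carry the value one when the word has support `S`. -/
def activeSockets (l : ℕ) (S : Finset (Fin n)) : Finset (VarSocket n l) :=
  S ×ˢ Finset.univ

theorem card_activeSockets (l : ℕ) (S : Finset (Fin n)) : #(activeSockets l S) = #S * l := by
  simp [activeSockets]

/-- The word with support `S`. -/
def wordOf (S : Finset (Fin n)) : Fin n → ZMod 2 := fun i => if i ∈ S then 1 else 0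

theorem wordOf_injective : Function.Injective (wordOf (n := n)) := by
  intro S T h
  ext i
  simpa [wordOf] using congrArg (· = 1) (congrFun h i)

theorem wordOf_surjective : Function.Surjective (wordOf (n := n)) := by
  intro x
  refine ⟨({i | x i = 1} : Finset (Fin n)), funext fun i => ?_⟩
  have hbit : ∀ z : ZMod 2, (if z = 1 then (1 : ZMod 2) else 0) = z := by decide
  simpa [wordOf] using hbit (x i)

theorem parityMatrix_mulVec_wordOf_eq_zero_iff (σ : VarSocket n l ≃ CheckSocket M)
    (S : Finset (Fin n)) :
    (parityMatrix σ).mulVec (wordOf S) = 0 ↔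
      IsEvenSet ((activeSockets l S).map σ.toEmbedding) := by
  rw [funext_iff]
  refine forall_congr' fun c => ?_
  have hcard : #{y ∈ (activeSockets l S).map σ.toEmbedding | y.1 = c} =
      ∑ i ∈ S, #{s : Fin l | (σ (i, s)).1 = c} := by
    rw [Finset.filter_map, Finset.card_map]
    simp only [Finset.card_filter, activeSockets, Finset.sum_product]
    rfl
  rw [hcard, ← ZMod.natCast_eq_zero_iff_even]
  simp [parityMatrix, Matrix.mulVec, dotProduct, wordOf, Finset.sum_ite_mem]

theorem numCodewords_eq_card (G : TannerGraph n l₁ l₂ M₁ M₂) :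
    numCodewords G = #{S : Finset (Fin n) |
      IsEvenSet ((activeSockets l₁ S).map G.1.toEmbedding) ∧
      IsEvenSet ((activeSockets l₂ S).map G.2.toEmbedding)} := by
  rw [← Set.ncard_coe_finset, ← Set.ncard_image_of_injective _ wordOf_injective, numCodewords]
  congr 1
  ext x
  obtain ⟨S, rfl⟩ := wordOf_surjective x
  simp [codewords, parityMatrix_mulVec_wordOf_eq_zero_iff, wordOf_injective.eq_iff]

theorem sum_numCodewords (n l₁ l₂ : ℕ) (M₁ M₂ : ℕ →₀ ℕ) :
    ∑ G : TannerGraph n l₁ l₂ M₁ M₂, numCodewords G = ∑ S : Finset (Fin n),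
      #{σ : VarSocket n l₁ ≃ CheckSocket M₁ |
        IsEvenSet ((activeSockets l₁ S).map σ.toEmbedding)} *
      #{σ : VarSocket n l₂ ≃ CheckSocket M₂ |
        IsEvenSet ((activeSockets l₂ S).map σ.toEmbedding)} := by
  simp only [numCodewords_eq_card, Finset.card_filter]
  rw [Finset.sum_comm]
  refine Finset.sum_congr rfl fun S _ => ?_
  rw [Fintype.sum_prod_type, Finset.sum_mul_sum]
  simp only [ite_and, mul_ite, mul_one, mul_zero]
  refine Finset.sum_congr rfl fun σ _ => Finset.sum_congr rfl fun τ _ => ?_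
  split_ifs <;> rfl

/-- The probability that a fixed word of weight `w` satisfies all checks of one type: the `w * l`
sockets carrying a one are matched with a uniformly random set of check node sockets. -/
noncomputable def evenProb (n l : ℕ) (M : ℕ →₀ ℕ) (w : ℕ) : ℝ :=
  evenCount M (w * l) / (n * l).choose (w * l)

theorem card_filter_isEvenSet_eq (hM : (M.sum fun r m => r * m) = n * l) (S : Finset (Fin n)) :
    (#{σ : VarSocket n l ≃ CheckSocket M | IsEvenSet ((activeSockets l S).map σ.toEmbedding)} : ℝ) =
      evenProb n l M #S * Fintype.card (VarSocket n l ≃ CheckSocket M) := by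
  have hchoose : 0 < (n * l).choose (#S * l) :=
    Nat.choose_pos (Nat.mul_le_mul_right _ (by simpa using S.card_le_univ))
  have hcard := card_equiv_filter_mul_choose (α := VarSocket n l) (β := CheckSocket M)
    (by rw [card_checkSocket, hM, card_varSocket]) (activeSockets l S) IsEvenSet
  rw [card_activeSockets, card_varSocket, ← evenCount] at hcard
  rw [evenProb, div_mul_eq_mul_div, eq_div_iff (by positivity)]
  exact_mod_cast hcard

theorem card_varSocket_equiv_pos (hM : (M.sum fun r m => r * m) = n * l) :
    0 < Fintype.card (VarSocket n l ≃ CheckSocket M) := by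
  rw [Fintype.card_pos_iff]
  exact Fintype.card_eq.1 (by rw [card_checkSocket, hM, card_varSocket])

theorem evenProb_nonneg (n l : ℕ) (M : ℕ →₀ ℕ) (w : ℕ) : 0 ≤ evenProb n l M w := by
  unfold evenProb
  positivity

/-- The expected number of codewords of weight `w`. -/
noncomputable def expWeightCount (n l₁ l₂ : ℕ) (M₁ M₂ : ℕ →₀ ℕ) (w : ℕ) : ℝ :=
  n.choose w * (evenProb n l₁ M₁ w * evenProb n l₂ M₂ w)

theorem expWeightCount_nonneg (n l₁ l₂ : ℕ) (M₁ M₂ : ℕ →₀ ℕ) (w : ℕ) :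
    0 ≤ expWeightCount n l₁ l₂ M₁ M₂ w :=
  mul_nonneg (Nat.cast_nonneg _) (mul_nonneg (evenProb_nonneg _ _ _ _) (evenProb_nonneg _ _ _ _))

theorem expNumCodewords_eq_sum (h₁ : (M₁.sum fun r m => r * m) = n * l₁)
    (h₂ : (M₂.sum fun r m => r * m) = n * l₂) :
    expNumCodewords n l₁ l₂ M₁ M₂ =
      ∑ w ∈ Finset.range (n + 1), expWeightCount n l₁ l₂ M₁ M₂ w := by
  have hpos₁ := card_varSocket_equiv_pos h₁
  have hpos₂ := card_varSocket_equiv_pos h₂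
  have hweight := Finset.sum_powerset_apply_card (x := (Finset.univ : Finset (Fin n)))
    fun w => evenProb n l₁ M₁ w * evenProb n l₂ M₂ w
  simp only [Finset.powerset_univ, Finset.card_univ, Fintype.card_fin, nsmul_eq_mul] at hweight
  rw [expNumCodewords, ← Nat.cast_sum, sum_numCodewords, Fintype.card_prod]
  unfold expWeightCount
  push_cast
  rw [← hweight, div_eq_iff (by positivity), Finset.sum_mul]
  refine Finset.sum_congr rfl fun S _ => ?_
  rw [card_filter_isEvenSet_eq h₁, card_filter_isEvenSet_eq h₂]
  ring

end Ensemble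

/-! ### Polynomials with nonnegative coefficients -/

section CoeffNonneg

/-- All coefficients of the polynomial are nonnegative, as for every counting polynomial. -/
def CoeffNonneg (p : ℝ[X]) : Prop := ∀ k, 0 ≤ p.coeff k

variable {p : ℝ[X]}

theorem CoeffNonneg.add {p₁ p₂ : ℝ[X]} (h₁ : CoeffNonneg p₁) (h₂ : CoeffNonneg p₂) :
    CoeffNonneg (p₁ + p₂) := fun k => by
  rw [Polynomial.coeff_add]
  exact add_nonneg (h₁ k) (h₂ k)

theorem CoeffNonneg.mul {p₁ p₂ : ℝ[X]} (h₁ : CoeffNonneg p₁) (h₂ : CoeffNonneg p₂) :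
    CoeffNonneg (p₁ * p₂) := fun k => by
  rw [Polynomial.coeff_mul]
  exact Finset.sum_nonneg fun x _ => mul_nonneg (h₁ _) (h₂ _)

theorem CoeffNonneg.prod {ι : Type*} {s : Finset ι} {p : ι → ℝ[X]}
    (h : ∀ i ∈ s, CoeffNonneg (p i)) : CoeffNonneg (∏ i ∈ s, p i) := by
  refine Finset.prod_induction _ CoeffNonneg (fun _ _ => CoeffNonneg.mul) (fun k => ?_) h
  rw [Polynomial.coeff_one]
  split_ifs <;> norm_num

theorem CoeffNonneg.coeff_mul_pow_le_eval (hp : CoeffNonneg p) {x : ℝ} (hx : 0 ≤ x) (k : ℕ) :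
    p.coeff k * x ^ k ≤ p.eval x := by
  have hterm : ∀ i, 0 ≤ p.coeff i * x ^ i := fun i => mul_nonneg (hp i) (pow_nonneg hx i)
  rw [Polynomial.eval_eq_sum, Polynomial.sum]
  by_cases hk : k ∈ p.support
  · exact Finset.single_le_sum (f := fun i => p.coeff i * x ^ i) (fun i _ => hterm i) hk
  · rw [Polynomial.notMem_support_iff.1 hk, zero_mul]
    exact Finset.sum_nonneg fun i _ => hterm i

theorem CoeffNonneg.coeff_zero_le_eval (hp : CoeffNonneg p) {x : ℝ} (hx : 0 ≤ x) :
    p.coeff 0 ≤ p.eval x := by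
  simpa using hp.coeff_mul_pow_le_eval hx 0

theorem CoeffNonneg.eval_le_eval_one_mul_pow (hp : CoeffNonneg p) {x : ℝ} (hx : 1 ≤ x) :
    p.eval x ≤ p.eval 1 * x ^ p.natDegree := by
  rw [Polynomial.eval_eq_sum_range, Polynomial.eval_eq_sum_range, Finset.sum_mul]
  refine Finset.sum_le_sum fun k hk => ?_
  rw [one_pow, mul_one]
  have hk : k ≤ p.natDegree := Nat.lt_succ_iff.1 (Finset.mem_range.1 hk)
  exact mul_le_mul_of_nonneg_left (pow_le_pow_right₀ hx hk) (hp k)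

theorem exists_eval_le_mul_coeff_mul_pow {N : ℕ} (hN : p.natDegree ≤ N) (x : ℝ) :
    ∃ k, p.eval x ≤ (N + 1) * (p.coeff k * x ^ k) := by
  obtain ⟨k, -, hk⟩ := Finset.exists_max_image (Finset.range (N + 1))
    (fun k => p.coeff k * x ^ k) ⟨0, by simp⟩
  refine ⟨k, ?_⟩
  rw [Polynomial.eval_eq_sum_range' (Nat.lt_succ_of_le hN)]
  refine (Finset.sum_le_card_nsmul _ _ _ hk).trans_eq ?_
  simp

end CoeffNonneg

/-! ### The mean degree of a weighted monomial -/

section MeanDegree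

/-- The mean of the degree `k` of the random monomial of `p` chosen with probability proportional
to `p.coeff k * x ^ k`. -/
noncomputable def meanDegree (p : ℝ[X]) (x : ℝ) : ℝ := x * p.derivative.eval x / p.eval x

theorem meanDegree_C (a x : ℝ) : meanDegree (Polynomial.C a) x = 0 := by simp [meanDegree]

theorem hasDerivAt_log_eval_exp {p : ℝ[X]} {t : ℝ} (hp : p.eval (Real.exp t) ≠ 0) :
    HasDerivAt (fun t => Real.log (p.eval (Real.exp t))) (meanDegree p (Real.exp t)) t := by
  rw [meanDegree, mul_comm]
  exact ((p.hasDerivAt (Real.exp t)).comp t (Real.hasDerivAt_exp t)).log hp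

theorem coeff_X_mul_derivative (p : ℝ[X]) (k : ℕ) :
    (Polynomial.X * p.derivative).coeff k = k * p.coeff k := by
  cases k with
  | zero => simp
  | succ k =>
    rw [Polynomial.coeff_X_mul, Polynomial.coeff_derivative]
    push_cast
    ring

theorem mul_eval_derivative_eq_sum_range (p : ℝ[X]) (x : ℝ) :
    x * p.derivative.eval x = ∑ k ∈ Finset.range (p.natDegree + 1), k * (p.coeff k * x ^ k) := by
  have hdeg : (Polynomial.X * p.derivative).natDegree < p.natDegree + 1 := by
    rw [Nat.lt_succ_iff, Polynomial.natDegree_le_iff_coeff_eq_zero]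
    intro k hk
    rw [coeff_X_mul_derivative, Polynomial.coeff_eq_zero_of_natDegree_lt hk, mul_zero]
  have heval := Polynomial.eval_eq_sum_range' hdeg x
  rw [Polynomial.eval_mul, Polynomial.eval_X] at heval
  simp only [heval, coeff_X_mul_derivative, mul_assoc]

theorem two_mul_sum_mul_sum_sub {ι : Type*} (s : Finset ι) (d a b : ι → ℝ) :
    2 * ((∑ i ∈ s, d i * b i) * ∑ i ∈ s, a i - (∑ i ∈ s, d i * a i) * ∑ i ∈ s, b i) =
      ∑ i ∈ s, ∑ j ∈ s, (d j - d i) * (a i * b j - a j * b i) := by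
  have hdb : ∑ i ∈ s, ∑ j ∈ s, d j * b j * a i = (∑ i ∈ s, d i * b i) * ∑ i ∈ s, a i := by
    rw [Finset.sum_mul_sum, Finset.sum_comm]
  have hda : ∑ i ∈ s, ∑ j ∈ s, d j * a j * b i = (∑ i ∈ s, d i * a i) * ∑ i ∈ s, b i := by
    rw [Finset.sum_mul_sum, Finset.sum_comm]
  have hdb' := Finset.sum_mul_sum s s (fun i => d i * b i) a
  have hda' := Finset.sum_mul_sum s s (fun i => d i * a i) b
  have hexpand : ∀ i j, (d j - d i) * (a i * b j - a j * b i) =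
      d j * b j * a i - d j * a j * b i - d i * a i * b j + d i * b i * a j := fun i j => by ring
  simp only [hexpand, Finset.sum_add_distrib, Finset.sum_sub_distrib, hdb, hda, ← hdb', ← hda']
  ring

theorem sub_mul_pow_mul_pow_sub_nonneg {x y : ℝ} (hx : 0 ≤ x) (hxy : x ≤ y) (i j : ℕ) :
    0 ≤ ((j : ℝ) - i) * (x ^ i * y ^ j - x ^ j * y ^ i) := by
  wlog hij : i ≤ j generalizing i j
  · linarith [this j i (not_le.1 hij).le]
  refine mul_nonneg (sub_nonneg.2 (by exact_mod_cast hij)) (sub_nonneg.2 ?_)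
  obtain ⟨m, rfl⟩ := Nat.exists_eq_add_of_le hij
  have hy : 0 ≤ y := hx.trans hxy
  calc x ^ (i + m) * y ^ i = x ^ i * y ^ i * x ^ m := by ring
    _ ≤ x ^ i * y ^ i * y ^ m := by gcongr
    _ = x ^ i * y ^ (i + m) := by ring

theorem CoeffNonneg.meanDegree_strictMonoOn {p : ℝ[X]} (hp : CoeffNonneg p)
    (h0 : 0 < p.coeff 0) (hdeg : 0 < p.natDegree) : StrictMonoOn (meanDegree p) (Ici 0) := by
  intro x hx y hy hxy
  have hlead : 0 < p.leadingCoeff := lt_of_le_of_ne (hp _)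
    (Polynomial.leadingCoeff_ne_zero.2 fun h => by simp [h] at hdeg).symm
  rw [meanDegree, meanDegree, div_lt_div_iff₀ (h0.trans_le (hp.coeff_zero_le_eval hx))
    (h0.trans_le (hp.coeff_zero_le_eval hy)), ← sub_pos, ← mul_pos_iff_of_pos_left two_pos,
    mul_eval_derivative_eq_sum_range, mul_eval_derivative_eq_sum_range,
    Polynomial.eval_eq_sum_range, Polynomial.eval_eq_sum_range, two_mul_sum_mul_sum_sub]
  have hterm : ∀ i j : ℕ, 0 ≤ ((j : ℝ) - i) *
      (p.coeff i * x ^ i * (p.coeff j * y ^ j) - p.coeff j * x ^ j * (p.coeff i * y ^ i)) := by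
    intro i j
    have h := mul_nonneg (mul_nonneg (hp i) (hp j)) (sub_mul_pow_mul_pow_sub_nonneg hx hxy.le i j)
    linarith
  have hinner : ∀ i : ℕ, 0 ≤ ∑ j ∈ Finset.range (p.natDegree + 1), ((j : ℝ) - i) *
      (p.coeff i * x ^ i * (p.coeff j * y ^ j) - p.coeff j * x ^ j * (p.coeff i * y ^ i)) :=
    fun i => Finset.sum_nonneg fun j _ => hterm i j
  refine Finset.sum_pos' (fun i _ => hinner i) ⟨0, by simp, ?_⟩
  refine Finset.sum_pos' (fun j _ => hterm 0 j) ⟨p.natDegree, by simp, ?_⟩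
  have hpow : 0 < y ^ p.natDegree - x ^ p.natDegree :=
    sub_pos.2 (pow_lt_pow_left₀ hxy hx hdeg.ne')
  have : (0 : ℝ) < p.natDegree := by exact_mod_cast hdeg
  calc (0 : ℝ) < p.natDegree * (p.coeff 0 * p.leadingCoeff *
        (y ^ p.natDegree - x ^ p.natDegree)) := by positivity
    _ = _ := by rw [Polynomial.leadingCoeff]; push_cast; ring

theorem CoeffNonneg.meanDegree_monotoneOn {p : ℝ[X]} (hp : CoeffNonneg p) (h0 : 0 < p.coeff 0) :
    MonotoneOn (meanDegree p) (Ici 0) := by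
  obtain hdeg | hdeg := Nat.eq_zero_or_pos p.natDegree
  · intro x _ y _ _
    rw [Polynomial.eq_C_of_natDegree_eq_zero hdeg, meanDegree_C, meanDegree_C]
  · exact (hp.meanDegree_strictMonoOn h0 hdeg).monotoneOn

theorem CoeffNonneg.meanDegree_continuousOn {p : ℝ[X]} (hp : CoeffNonneg p) (h0 : 0 < p.coeff 0) :
    ContinuousOn (meanDegree p) (Ici 0) :=
  (continuousOn_id.mul p.derivative.continuousOn).div p.continuousOn
    fun _ hx => (h0.trans_le (hp.coeff_zero_le_eval hx)).ne'

theorem tendsto_meanDegree_atTop {p : ℝ[X]} (hp : p ≠ 0) :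
    Tendsto (meanDegree p) atTop (𝓝 p.natDegree) := by
  obtain hdeg | hdeg := Nat.eq_zero_or_pos p.natDegree
  · rw [hdeg, Polynomial.eq_C_of_natDegree_eq_zero hdeg]
    simp only [Nat.cast_zero, funext (meanDegree_C _), tendsto_const_nhds]
  have hdegree : (Polynomial.X * p.derivative).degree = p.degree := by
    rw [Polynomial.degree_mul, Polynomial.degree_X, Polynomial.degree_derivative hdeg.ne',
      Polynomial.degree_eq_natDegree hp]
    exact_mod_cast (by omega : 1 + (p.natDegree - 1) = p.natDegree)
  have hlead : (Polynomial.X * p.derivative).leadingCoeff / p.leadingCoeff = p.natDegree := by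
    rw [Polynomial.leadingCoeff, Polynomial.natDegree_eq_of_degree_eq hdegree,
      coeff_X_mul_derivative]
    exact mul_div_cancel_right₀ _ (Polynomial.leadingCoeff_ne_zero.2 hp)
  have hlim := Polynomial.div_tendsto_atTop_leadingCoeff_div_of_degree_eq _ _ hdegree
  rw [hlead] at hlim
  exact hlim.congr fun x => by rw [Polynomial.eval_mul, Polynomial.eval_X, meanDegree]

end MeanDegree

/-! ### Comparing the coefficients of `X ^ s` and `X ^ (s + 2)` -/

section TwoStep

open Polynomial in
/-- The operator `p ↦ a X p' + b X² (X p' - d p)`, which compares the coefficients of `X ^ s` and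
`X ^ (s + 2)`. It satisfies the Leibniz rule if `d` is regarded as a degree that is additive under
multiplication. -/
noncomputable def twoStep (a b d : ℝ) (p : ℝ[X]) : ℝ[X] :=
  C a * (X * derivative p) + C b * (X * derivative p - C d * p) * X ^ 2

theorem twoStep_mul (a b d₁ d₂ : ℝ) (p₁ p₂ : ℝ[X]) :
    twoStep a b (d₁ + d₂) (p₁ * p₂) = twoStep a b d₁ p₁ * p₂ + p₁ * twoStep a b d₂ p₂ := by
  simp only [twoStep, Polynomial.derivative_mul, Polynomial.C_add]
  ring

theorem coeff_twoStep (a b d : ℝ) (p : ℝ[X]) (k : ℕ) :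
    (twoStep a b d p).coeff (k + 2) =
      a * ((k + 2) * p.coeff (k + 2)) + b * ((k - d) * p.coeff k) := by
  rw [twoStep, Polynomial.coeff_add, Polynomial.coeff_mul_X_pow, Polynomial.coeff_C_mul,
    Polynomial.coeff_C_mul, Polynomial.coeff_sub, Polynomial.coeff_C_mul, coeff_X_mul_derivative,
    coeff_X_mul_derivative]
  push_cast
  ring

theorem coeffNonneg_twoStep {a b d : ℝ} {p : ℝ[X]} (h1 : p.coeff 1 = 0)
    (h : ∀ k : ℕ, b * ((d - k) * p.coeff k) ≤ a * ((k + 2) * p.coeff (k + 2))) :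
    CoeffNonneg (twoStep a b d p) := by
  intro k
  match k with
  | 0 => simp [twoStep]
  | 1 => simp [twoStep, Polynomial.coeff_mul_X_pow', Polynomial.coeff_derivative, h1]
  | k + 2 =>
    rw [coeff_twoStep]
    linarith [h k]

theorem coeffNonneg_twoStep_prod {ι : Type*} {s : Finset ι} {a b : ℝ} {d : ι → ℝ} {p : ι → ℝ[X]}
    (h0 : ∀ i ∈ s, CoeffNonneg (p i)) (h : ∀ i ∈ s, CoeffNonneg (twoStep a b (d i) (p i))) :
    CoeffNonneg (twoStep a b (∑ i ∈ s, d i) (∏ i ∈ s, p i)) := by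
  classical
  induction s using Finset.induction_on with
  | empty => intro k; simp [twoStep]
  | insert i s hi ih =>
    simp only [Finset.forall_mem_insert] at h0 h
    rw [Finset.sum_insert hi, Finset.prod_insert hi, twoStep_mul]
    exact (h.1.mul (CoeffNonneg.prod h0.2)).add (h0.1.mul (ih h0.2 h.2))

end TwoStep

/-! ### Generating polynomials of even sets -/

section SizeEnumerator

/-- The generating polynomial, by size, of the subsets of a finite type that satisfy `P`. -/
noncomputable def sizeEnumerator {ι : Type*} [Fintype ι] (P : Finset ι → Prop) [DecidablePred P] :
    ℝ[X] :=
  ∑ T : Finset ι, if P T then Polynomial.X ^ #T else 0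

theorem coeff_sizeEnumerator {ι : Type*} [Fintype ι] (P : Finset ι → Prop) [DecidablePred P]
    (s : ℕ) : (sizeEnumerator P).coeff s = #{T : Finset ι | #T = s ∧ P T} := by
  have hterm : ∀ T : Finset ι,
      (if P T then (Polynomial.X : ℝ[X]) ^ #T else 0).coeff s = if #T = s ∧ P T then 1 else 0 := by
    intro T
    split_ifs <;> simp_all [Polynomial.coeff_X_pow, eq_comm]
  simp only [sizeEnumerator, Polynomial.finsetSum_coeff, hterm, Finset.sum_boole]

theorem coeffNonneg_sizeEnumerator {ι : Type*} [Fintype ι] (P : Finset ι → Prop)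
    [DecidablePred P] : CoeffNonneg (sizeEnumerator P) := fun s => by
  rw [coeff_sizeEnumerator]
  positivity

theorem natDegree_sizeEnumerator_le {ι : Type*} [Fintype ι] (P : Finset ι → Prop)
    [DecidablePred P] : (sizeEnumerator P).natDegree ≤ Fintype.card ι := by
  rw [Polynomial.natDegree_le_iff_coeff_eq_zero]
  intro s hs
  rw [coeff_sizeEnumerator, Nat.cast_eq_zero, Finset.card_eq_zero, Finset.filter_eq_empty_iff]
  rintro T - ⟨rfl, -⟩
  exact hs.not_ge T.card_le_univ

variable {κ : Type*} {ι : κ → Type*} [Fintype κ] [∀ c, Fintype (ι c)] [DecidableEq κ]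

open scoped Classical in
/-- A finite subset of a disjoint union is a family of finite subsets of the parts. -/
noncomputable def finsetSigmaEquiv : (∀ c, Finset (ι c)) ≃ Finset (Σ c, ι c) where
  toFun T := Finset.univ.sigma T
  invFun T c := {i | ⟨c, i⟩ ∈ T}
  left_inv T := by ext; simp
  right_inv T := by ext ⟨c, i⟩; simp

theorem card_finsetSigmaEquiv (T : ∀ c, Finset (ι c)) : #(finsetSigmaEquiv T) = ∑ c, #(T c) := by
  simp [finsetSigmaEquiv]

theorem card_filter_finsetSigmaEquiv (T : ∀ c, Finset (ι c)) (c : κ) :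
    #{y ∈ finsetSigmaEquiv T | y.1 = c} = #(T c) := by
  have hfiber : ({y ∈ finsetSigmaEquiv T | y.1 = c} : Finset (Σ c, ι c)) =
      (T c).map (Function.Embedding.sigmaMk c) := by
    ext ⟨c', i⟩
    simp only [finsetSigmaEquiv, Equiv.coe_fn_mk, Finset.mem_filter, Finset.mem_sigma,
      Finset.mem_univ, true_and, Finset.mem_map, Function.Embedding.sigmaMk_apply, Sigma.mk.injEq]
    constructor
    · rintro ⟨hi, rfl⟩
      exact ⟨i, hi, rfl, HEq.rfl⟩
    · rintro ⟨j, hj, rfl, hji⟩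
      exact ⟨eq_of_heq hji ▸ hj, rfl⟩
  rw [hfiber, Finset.card_map]

theorem sizeEnumerator_sigma (P : ℕ → Prop) [DecidablePred P] :
    sizeEnumerator (fun T : Finset (Σ c, ι c) => ∀ c, P #{y ∈ T | y.1 = c}) =
      ∏ c, sizeEnumerator fun T : Finset (ι c) => P #T := by
  simp only [sizeEnumerator]
  rw [Finset.prod_univ_sum, Fintype.piFinset_univ, ← finsetSigmaEquiv.sum_comp]
  refine Finset.sum_congr rfl fun T _ => ?_
  simp only [card_filter_finsetSigmaEquiv, card_finsetSigmaEquiv, Finset.prod_ite_zero,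
    Finset.mem_univ, true_imp_iff, Finset.prod_pow_eq_pow_sum]

end SizeEnumerator

section EvenPoly

/-- The generating polynomial, by size, of the subsets of even size of an `r`-element set. -/
noncomputable def evenPoly (r : ℕ) : ℝ[X] := sizeEnumerator fun T : Finset (Fin r) => Even #T

theorem coeffNonneg_evenPoly (r : ℕ) : CoeffNonneg (evenPoly r) := coeffNonneg_sizeEnumerator _

theorem coeff_evenPoly_of_even (r : ℕ) {s : ℕ} (hs : Even s) :
    (evenPoly r).coeff s = r.choose s := by
  have hfilter : ({T : Finset (Fin r) | #T = s ∧ Even #T} : Finset (Finset (Fin r))) =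
      ({T | #T = s} : Finset (Finset (Fin r))) := by
    refine Finset.filter_congr fun T _ => and_iff_left_of_imp ?_
    rintro rfl
    exact hs
  rw [evenPoly, coeff_sizeEnumerator, hfilter, Finset.univ_filter_card_eq, Finset.card_powersetCard,
    Finset.card_univ, Fintype.card_fin]

theorem coeff_evenPoly_of_odd (r : ℕ) {s : ℕ} (hs : Odd s) : (evenPoly r).coeff s = 0 := by
  rw [evenPoly, coeff_sizeEnumerator, Nat.cast_eq_zero, Finset.card_eq_zero,
    Finset.filter_eq_empty_iff]
  rintro T - ⟨rfl, hT⟩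
  exact Nat.not_even_iff_odd.2 hs hT

theorem coeff_zero_evenPoly (r : ℕ) : (evenPoly r).coeff 0 = 1 := by
  rw [coeff_evenPoly_of_even r Even.zero, Nat.choose_zero_right, Nat.cast_one]

theorem coeff_zero_evenPoly_pos (r : ℕ) : 0 < (evenPoly r).coeff 0 := by
  rw [coeff_zero_evenPoly]
  exact one_pos

theorem natDegree_evenPoly (r : ℕ) : (evenPoly r).natDegree = 2 * (r / 2) := by
  refine Polynomial.natDegree_eq_of_le_of_coeff_ne_zero ?_ ?_
  · rw [Polynomial.natDegree_le_iff_coeff_eq_zero]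
    intro s hs
    obtain heven | hodd := s.even_or_odd
    · have hrs : r < s := by obtain ⟨k, rfl⟩ := heven; omega
      rw [coeff_evenPoly_of_even r heven, Nat.choose_eq_zero_of_lt hrs, Nat.cast_zero]
    · exact coeff_evenPoly_of_odd r hodd
  · rw [coeff_evenPoly_of_even r (even_two_mul _), Nat.cast_ne_zero]
    exact (Nat.choose_pos (Nat.mul_div_le r 2)).ne'

theorem eval_evenPoly (r : ℕ) (v : ℝ) : (evenPoly r).eval v = q r v := by
  have hplus := Fin.sum_pow_mul_eq_add_pow (n := r) v 1
  have hminus := Fin.sum_pow_mul_eq_add_pow (n := r) (-v) 1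
  simp only [one_pow, mul_one] at hplus hminus
  rw [q, add_comm 1 v, sub_eq_neg_add 1 v, ← hplus, ← hminus, evenPoly, sizeEnumerator,
    Polynomial.eval_finsetSum, ← Finset.sum_add_distrib, Finset.sum_div]
  refine Finset.sum_congr rfl fun T _ => ?_
  split_ifs with hT
  · rw [Polynomial.eval_pow, Polynomial.eval_X, hT.neg_pow]
    ring
  · rw [Polynomial.eval_zero, (Nat.not_even_iff_odd.1 hT).neg_pow]
    ring

theorem one_le_q (r : ℕ) {v : ℝ} (hv : 0 ≤ v) : 1 ≤ q r v := by
  rw [← eval_evenPoly, ← coeff_zero_evenPoly r]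
  exact (coeffNonneg_evenPoly r).coeff_zero_le_eval hv

theorem q_pos (r : ℕ) {v : ℝ} (hv : 0 ≤ v) : 0 < q r v := one_pos.trans_le (one_le_q r hv)

theorem choose_add_two_mul (r s : ℕ) :
    r.choose (s + 2) * ((s + 2) * (s + 1)) = r.choose s * ((r - s) * (r - s - 1)) := by
  calc r.choose (s + 2) * ((s + 2) * (s + 1))
      = r.choose (s + 1 + 1) * (s + 1 + 1) * (s + 1) := by ring
    _ = r.choose (s + 1) * (s + 1) * (r - (s + 1)) := by
      rw [Nat.choose_succ_right_eq, mul_right_comm]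
    _ = r.choose s * ((r - s) * (r - s - 1)) := by
      rw [Nat.choose_succ_right_eq, mul_assoc, Nat.sub_sub]

theorem sub_mul_choose_le_mul_choose_add_two (r : ℕ) {s : ℕ} (hs : Even s) :
    (2 * (r / 2) - s) * r.choose s ≤ r * ((s + 2) * r.choose (s + 2)) := by
  obtain hle | hlt := le_or_gt (2 * (r / 2)) s
  · simp [Nat.sub_eq_zero_of_le hle]
  have hone : 1 ≤ r - s - 1 := by obtain ⟨k, rfl⟩ := hs; omega
  calc (2 * (r / 2) - s) * r.choose s ≤ (r - s) * (r - s - 1) * r.choose s :=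
        Nat.mul_le_mul_right _ ((by omega : 2 * (r / 2) - s ≤ r - s).trans
          (Nat.le_mul_of_pos_right _ hone))
    _ = (s + 1) * ((s + 2) * r.choose (s + 2)) := by rw [mul_comm, ← choose_add_two_mul]; ring
    _ ≤ r * ((s + 2) * r.choose (s + 2)) := Nat.mul_le_mul_right _ (by omega)

theorem mul_choose_add_two_le_sub_mul_choose (r s : ℕ) :
    (s + 2) * r.choose (s + 2) ≤ r * ((2 * (r / 2) - s) * r.choose s) := by
  obtain hle | hlt := le_or_gt (2 * (r / 2)) s
  · simp [Nat.choose_eq_zero_of_lt (show r < s + 2 by omega)]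
  have hsub : r - s - 1 ≤ 2 * (r / 2) - s := by omega
  calc (s + 2) * r.choose (s + 2) ≤ (s + 2) * r.choose (s + 2) * (s + 1) :=
        Nat.le_mul_of_pos_right _ s.succ_pos
    _ = (r - s) * ((r - s - 1) * r.choose s) := by
      rw [mul_comm _ (r.choose s), mul_left_comm, ← choose_add_two_mul]; ring
    _ ≤ r * ((2 * (r / 2) - s) * r.choose s) :=
      Nat.mul_le_mul (Nat.sub_le r s) (Nat.mul_le_mul_right _ hsub)

theorem cast_sub_mul_choose (r : ℕ) {s : ℕ} (hs : Even s) :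
    (((2 * (r / 2) - s) * r.choose s : ℕ) : ℝ) = ((2 * (r / 2) : ℕ) - s) * r.choose s := by
  obtain hle | hlt := le_or_gt s (2 * (r / 2))
  · rw [Nat.cast_mul, Nat.cast_sub hle]
  · have hr : r < s := by obtain ⟨k, rfl⟩ := hs; omega
    simp [Nat.choose_eq_zero_of_lt hr]

theorem coeffNonneg_twoStep_evenPoly {r R : ℕ} (hr : r ≤ R) :
    CoeffNonneg (twoStep R 1 (2 * (r / 2) : ℕ) (evenPoly r)) := by
  refine coeffNonneg_twoStep (coeff_evenPoly_of_odd r odd_one) fun s => ?_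
  obtain hs | hs := s.even_or_odd
  · rw [coeff_evenPoly_of_even r hs, coeff_evenPoly_of_even r (hs.add even_two),
      ← cast_sub_mul_choose r hs, one_mul]
    exact_mod_cast (sub_mul_choose_le_mul_choose_add_two r hs).trans (Nat.mul_le_mul_right _ hr)
  · rw [coeff_evenPoly_of_odd r hs, coeff_evenPoly_of_odd r (hs.add_even even_two)]
    simp

theorem coeffNonneg_twoStep_neg_evenPoly {r R : ℕ} (hr : r ≤ R) :
    CoeffNonneg (twoStep (-1) (-R) (2 * (r / 2) : ℕ) (evenPoly r)) := by
  refine coeffNonneg_twoStep (coeff_evenPoly_of_odd r odd_one) fun s => ?_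
  obtain hs | hs := s.even_or_odd
  · rw [coeff_evenPoly_of_even r hs, coeff_evenPoly_of_even r (hs.add even_two),
      ← cast_sub_mul_choose r hs, neg_mul, neg_mul, neg_le_neg_iff, one_mul]
    exact_mod_cast (mul_choose_add_two_le_sub_mul_choose r s).trans (Nat.mul_le_mul_right _ hr)
  · rw [coeff_evenPoly_of_odd r hs, coeff_evenPoly_of_odd r (hs.add_even even_two)]
    simp

end EvenPoly

section EvenCount

variable {M : ℕ →₀ ℕ}

/-- The generating polynomial, by size, of the even sets of check node sockets. -/
noncomputable def checkPoly (M : ℕ →₀ ℕ) : ℝ[X] :=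
  sizeEnumerator fun T : Finset (CheckSocket M) => IsEvenSet T

theorem coeff_checkPoly (M : ℕ →₀ ℕ) (s : ℕ) : (checkPoly M).coeff s = evenCount M s :=
  coeff_sizeEnumerator _ s

theorem checkPoly_eq_prod (M : ℕ →₀ ℕ) : checkPoly M = ∏ c : CheckNode M, evenPoly c.1 :=
  sizeEnumerator_sigma Even

theorem eval_checkPoly (M : ℕ →₀ ℕ) (v : ℝ) :
    (checkPoly M).eval v = M.prod fun r m => q r v ^ m := by
  rw [checkPoly_eq_prod, Polynomial.eval_prod, ← prod_checkNode M fun r => q r v]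
  simp only [eval_evenPoly]

theorem evenCount_mul_pow_le (M : ℕ →₀ ℕ) (s : ℕ) {v : ℝ} (hv : 0 ≤ v) :
    evenCount M s * v ^ s ≤ M.prod fun r m => q r v ^ m := by
  rw [← coeff_checkPoly, ← eval_checkPoly]
  exact (coeffNonneg_sizeEnumerator _).coeff_mul_pow_le_eval hv s

theorem evenCount_of_odd (M : ℕ →₀ ℕ) {s : ℕ} (hs : Odd s) : evenCount M s = 0 := by
  rw [evenCount, Finset.card_eq_zero, Finset.filter_eq_empty_iff]
  rintro T - ⟨rfl, hT⟩
  refine Nat.not_even_iff_odd.2 hs ?_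
  rw [Finset.card_eq_sum_card_fiberwise (t := Finset.univ) fun y _ => Finset.mem_coe.2
    (Finset.mem_univ y.1)]
  exact Finset.even_sum _ fun c _ => hT c

theorem exists_prod_q_pow_le (M : ℕ →₀ ℕ) (v : ℝ) :
    ∃ k, (M.prod fun r m => q r v ^ m) ≤
      ((M.sum fun r m => r * m : ℕ) + 1) * (evenCount M (2 * k) * v ^ (2 * k)) := by
  obtain ⟨s, hs⟩ := exists_eval_le_mul_coeff_mul_pow (natDegree_sizeEnumerator_le
    fun T : Finset (CheckSocket M) => IsEvenSet T) v
  rw [card_checkSocket, ← checkPoly, eval_checkPoly, coeff_checkPoly] at hs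
  obtain heven | hodd := s.even_or_odd
  · obtain ⟨k, rfl⟩ := heven.two_dvd
    exact ⟨k, hs⟩
  · rw [evenCount_of_odd M hodd, Nat.cast_zero, zero_mul, mul_zero] at hs
    exact ⟨0, hs.trans (mul_nonneg (by positivity) (by simp))⟩

/-- The largest size of an even set of check node sockets. -/
def maxEvenSize (M : ℕ →₀ ℕ) : ℕ := M.sum fun r m => m * (2 * (r / 2))

theorem maxEvenSize_eq_sum (M : ℕ →₀ ℕ) :
    (maxEvenSize M : ℝ) = ∑ c : CheckNode M, ((2 * (c.1 / 2) : ℕ) : ℝ) := by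
  rw [← Nat.cast_sum, sum_checkNode M fun r => 2 * (r / 2)]
  rfl

variable {R : ℕ}

theorem sub_mul_evenCount_le (hR : ∀ r ∈ M.support, r ≤ R) (s : ℕ) :
    ((maxEvenSize M : ℝ) - s) * evenCount M s ≤ R * ((s + 2) * evenCount M (s + 2)) := by
  have h := coeffNonneg_twoStep_prod (s := Finset.univ) (a := R) (b := 1)
    (fun (c : CheckNode M) _ => coeffNonneg_evenPoly c.1)
    (fun c _ => coeffNonneg_twoStep_evenPoly (hR c.1 c.1.2)) (s + 2)
  rw [← maxEvenSize_eq_sum, ← checkPoly_eq_prod, coeff_twoStep, coeff_checkPoly,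
    coeff_checkPoly] at h
  linarith

theorem mul_evenCount_add_two_le (hR : ∀ r ∈ M.support, r ≤ R) (s : ℕ) :
    (s + 2) * (evenCount M (s + 2) : ℝ) ≤ R * (((maxEvenSize M : ℝ) - s) * evenCount M s) := by
  have h := coeffNonneg_twoStep_prod (s := Finset.univ) (a := -1) (b := -R)
    (fun (c : CheckNode M) _ => coeffNonneg_evenPoly c.1)
    (fun c _ => coeffNonneg_twoStep_neg_evenPoly (hR c.1 c.1.2)) (s + 2)
  rw [← maxEvenSize_eq_sum, ← checkPoly_eq_prod, coeff_twoStep, coeff_checkPoly,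
    coeff_checkPoly] at h
  linarith

theorem div_mul_evenCount_le_evenCount_add_two (hR : ∀ r ∈ M.support, r ≤ R) {d B : ℝ}
    {s : ℕ} (hs : s ≤ maxEvenSize M - d) (hB : s + 2 ≤ B) :
    d / (R * B) * evenCount M s ≤ evenCount M (s + 2) := by
  have hB0 : 0 ≤ B := le_trans (by positivity) hB
  rw [div_mul_eq_mul_div]
  refine div_le_of_le_mul₀ (by positivity) (by positivity) ?_
  calc d * evenCount M s ≤ (maxEvenSize M - s) * evenCount M s := by gcongr; linarith
    _ ≤ R * ((s + 2) * evenCount M (s + 2)) := sub_mul_evenCount_le hR s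
    _ ≤ R * (B * evenCount M (s + 2)) := by gcongr
    _ = evenCount M (s + 2) * (R * B) := by ring

theorem div_mul_evenCount_add_two_le_evenCount (hR : ∀ r ∈ M.support, r ≤ R) {d B : ℝ}
    (hB : maxEvenSize M ≤ B) {s : ℕ} (hs : d ≤ s + 2) :
    d / (R * B) * evenCount M (s + 2) ≤ evenCount M s := by
  have hB0 : 0 ≤ B := le_trans (by positivity) hB
  rw [div_mul_eq_mul_div]
  refine div_le_of_le_mul₀ (by positivity) (by positivity) ?_
  calc d * evenCount M (s + 2) ≤ (s + 2) * evenCount M (s + 2) := by gcongr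
    _ ≤ R * ((maxEvenSize M - s) * evenCount M s) := mul_evenCount_add_two_le hR s
    _ ≤ R * (B * evenCount M s) := by gcongr; linarith [(Nat.cast_nonneg s : (0 : ℝ) ≤ s)]
    _ = evenCount M s * (R * B) := by ring

theorem pow_mul_evenCount_le (hR : ∀ r ∈ M.support, r ≤ R) {d B : ℝ} (hd : 0 ≤ d)
    (hB : maxEvenSize M ≤ B) {i j : ℕ} (hi : (↑(2 * i) : ℝ) ∈ Set.Icc d (maxEvenSize M - d))
    (hj : (↑(2 * j) : ℝ) ∈ Set.Icc d (maxEvenSize M - d)) :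
    (d / (R * B)) ^ (max i j - min i j) * evenCount M (2 * i) ≤ evenCount M (2 * j) := by
  have hc : 0 ≤ d / (R * B) :=
    div_nonneg hd (mul_nonneg (Nat.cast_nonneg R) ((Nat.cast_nonneg _).trans hB))
  simp only [Set.mem_Icc, Nat.cast_mul, Nat.cast_ofNat] at hi hj
  obtain hij | hij := le_total i j <;> obtain ⟨m, rfl⟩ := Nat.exists_eq_add_of_le hij <;>
    simp only [hij, max_eq_right, min_eq_left, max_eq_left, min_eq_right, add_tsub_cancel_left] <;>
    push_cast at hi hj
  · refine geom_le (u := fun k => (evenCount M (2 * (i + k)) : ℝ)) hc m fun k hk => ?_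
    have hk : (k : ℝ) + 1 ≤ m := mod_cast hk
    exact div_mul_evenCount_le_evenCount_add_two hR (by push_cast; linarith)
      (by push_cast; linarith)
  · have hstep : ∀ k < m, d / (R * B) * evenCount M (2 * (j + (m - k))) ≤
        evenCount M (2 * (j + (m - (k + 1)))) := by
      intro k hk
      rw [show m - k = m - (k + 1) + 1 by lia]
      refine div_mul_evenCount_add_two_le_evenCount (s := 2 * (j + (m - (k + 1)))) hR hB ?_
      push_cast
      linarith [(Nat.cast_nonneg (m - (k + 1)) : (0 : ℝ) ≤ (m - (k + 1) : ℕ))]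
    simpa using geom_le (u := fun k => (evenCount M (2 * (j + (m - k))) : ℝ)) hc m hstep

end EvenCount

/-! ### The saddle point equation -/

section SaddlePoint

/-- A degree distribution with some degree larger than one. This excludes `avgDegree Γ = 0` and
makes the saddle point equation solvable. -/
structure IsProperDegreeDist (Γ : ℝ[X]) : Prop extends IsDegreeDist Γ where
  exists_two_le : ∃ r, 2 ≤ r ∧ Γ.coeff r ≠ 0

variable {Γ : ℝ[X]}

theorem avgDegree_eq_sum (Γ : ℝ[X]) : avgDegree Γ = Γ.sum fun r g => g * r := by
  rw [avgDegree, Polynomial.derivative_eval]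
  simp only [one_pow, mul_one]

theorem meanDegree_evenPoly (r : ℕ) (v : ℝ) :
    meanDegree (evenPoly r) v =
      r * v * (((1 + v) ^ (r - 1) - (1 - v) ^ (r - 1)) / ((1 + v) ^ r + (1 - v) ^ r)) := by
  have hq : HasDerivAt (q r)
      (((r : ℝ) * (1 + v) ^ (r - 1) * 1 + r * (1 - v) ^ (r - 1) * -1) / 2) v :=
    ((((hasDerivAt_id v).const_add 1).pow r).add
      (((hasDerivAt_id v).const_sub 1).pow r)).div_const 2
  have hderiv : (evenPoly r).derivative.eval v =
      r * ((1 + v) ^ (r - 1) - (1 - v) ^ (r - 1)) / 2 := by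
    rw [((evenPoly r).hasDerivAt v).unique (by simpa only [eval_evenPoly] using hq)]
    ring
  rw [meanDegree, hderiv, eval_evenPoly, q, mul_div_assoc', div_div_div_cancel_right₀ two_ne_zero]
  ring

theorem saddle_eq_sum (Γ : ℝ[X]) (v : ℝ) :
    saddle Γ v = (Γ.sum fun r g => g * meanDegree (evenPoly r) v) / avgDegree Γ := by
  rw [saddle, Polynomial.sum, Polynomial.sum, Finset.mul_sum, Finset.sum_div]
  refine Finset.sum_congr rfl fun r _ => ?_
  rw [meanDegree_evenPoly]
  ring

theorem saddle_continuousOn (Γ : ℝ[X]) : ContinuousOn (saddle Γ) (Ici 0) := by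
  rw [funext (saddle_eq_sum Γ)]
  exact (continuousOn_finsetSum _ fun r _ => ((coeffNonneg_evenPoly r).meanDegree_continuousOn
    (coeff_zero_evenPoly_pos r)).const_mul _).div_const _

theorem saddle_zero (Γ : ℝ[X]) : saddle Γ 0 = 0 := by simp [saddle]

namespace IsProperDegreeDist

theorem avgDegree_pos (hΓ : IsProperDegreeDist Γ) : 0 < avgDegree Γ := by
  obtain ⟨r, hr, hr0⟩ := hΓ.exists_two_le
  rw [avgDegree_eq_sum]
  refine Finset.sum_pos' (fun i _ => mul_nonneg (hΓ.nonneg i) (Nat.cast_nonneg i))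
    ⟨r, Polynomial.mem_support_iff.2 hr0, mul_pos ((hΓ.nonneg r).lt_of_ne' hr0) ?_⟩
  exact_mod_cast two_pos.trans_le hr

theorem maxFraction_eq_sum (hΓ : IsProperDegreeDist Γ) :
    maxFraction Γ = (Γ.sum fun r g => g * (evenPoly r).natDegree) / avgDegree Γ := by
  rw [maxFraction, eq_div_iff hΓ.avgDegree_pos.ne', sub_mul, one_mul,
    div_mul_cancel₀ _ hΓ.avgDegree_pos.ne', avgDegree_eq_sum, Polynomial.sum, Polynomial.sum,
    Polynomial.sum, ← Finset.sum_sub_distrib]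
  refine Finset.sum_congr rfl fun r _ => ?_
  rw [natDegree_evenPoly]
  split_ifs with hr
  · rw [← Nat.two_mul_div_two_add_one_of_odd hr]
    simp [Nat.mul_add_div]
    ring
  · rw [Nat.two_mul_div_two_of_even (Nat.not_odd_iff_even.1 hr), sub_zero]

theorem maxFraction_le_one (hΓ : IsProperDegreeDist Γ) : maxFraction Γ ≤ 1 := by
  refine sub_le_self _ (div_nonneg (Finset.sum_nonneg fun r _ => ?_) hΓ.avgDegree_pos.le)
  dsimp only
  split_ifs
  exacts [hΓ.nonneg r, le_rfl]

theorem saddle_strictMonoOn (hΓ : IsProperDegreeDist Γ) : StrictMonoOn (saddle Γ) (Ici 0) := by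
  intro u hu v hv huv
  obtain ⟨r, hr, hr0⟩ := hΓ.exists_two_le
  rw [saddle_eq_sum, saddle_eq_sum]
  refine div_lt_div_of_pos_right (Finset.sum_lt_sum (fun i _ => ?_)
    ⟨r, Polynomial.mem_support_iff.2 hr0, ?_⟩) hΓ.avgDegree_pos
  · exact mul_le_mul_of_nonneg_left ((coeffNonneg_evenPoly i).meanDegree_monotoneOn
      (coeff_zero_evenPoly_pos i) hu hv huv.le) (hΓ.nonneg i)
  · have hdeg : 0 < (evenPoly r).natDegree := by rw [natDegree_evenPoly]; lia
    exact mul_lt_mul_of_pos_left ((coeffNonneg_evenPoly r).meanDegree_strictMonoOn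
      (coeff_zero_evenPoly_pos r) hdeg hu hv huv) ((hΓ.nonneg r).lt_of_ne' hr0)

theorem tendsto_saddle_atTop (hΓ : IsProperDegreeDist Γ) :
    Tendsto (saddle Γ) atTop (𝓝 (maxFraction Γ)) := by
  rw [funext (saddle_eq_sum Γ), hΓ.maxFraction_eq_sum]
  refine (tendsto_finsetSum _ fun r _ => (tendsto_meanDegree_atTop ?_).const_mul _).div_const _
  intro h
  simpa [h] using coeff_zero_evenPoly_pos r

theorem saddle_pos (hΓ : IsProperDegreeDist Γ) {v : ℝ} (hv : 0 < v) : 0 < saddle Γ v :=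
  (saddle_zero Γ).symm.trans_lt (hΓ.saddle_strictMonoOn self_mem_Ici hv.le hv)

theorem saddle_lt_maxFraction (hΓ : IsProperDegreeDist Γ) {v : ℝ} (hv : 0 ≤ v) :
    saddle Γ v < maxFraction Γ := by
  have hv1 : v + 1 ∈ Ici (0 : ℝ) := by simp only [mem_Ici]; positivity
  refine (hΓ.saddle_strictMonoOn hv hv1 (lt_add_one v)).trans_le
    (ge_of_tendsto hΓ.tendsto_saddle_atTop ?_)
  filter_upwards [eventually_ge_atTop (v + 1)] with w hw
  exact hΓ.saddle_strictMonoOn.monotoneOn hv1 (hv1.trans hw) hw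

theorem maxFraction_pos (hΓ : IsProperDegreeDist Γ) : 0 < maxFraction Γ :=
  (saddle_zero Γ).symm.trans_lt (hΓ.saddle_lt_maxFraction le_rfl)

theorem exists_saddle_eq_iff (hΓ : IsProperDegreeDist Γ) {e : ℝ} :
    (∃ v, 0 < v ∧ saddle Γ v = e) ↔ e ∈ Ioo 0 (maxFraction Γ) := by
  constructor
  · rintro ⟨v, hv, rfl⟩
    exact ⟨hΓ.saddle_pos hv, hΓ.saddle_lt_maxFraction hv.le⟩
  · rintro ⟨h0, h1⟩
    obtain ⟨w, hw0, hw⟩ := ((eventually_gt_atTop 0).and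
      (hΓ.tendsto_saddle_atTop.eventually_const_lt h1)).exists
    obtain ⟨v, hv, hve⟩ := intermediate_value_Ioo hw0.le
      ((saddle_continuousOn Γ).mono Icc_subset_Ici_self)
      (show e ∈ Ioo (saddle Γ 0) (saddle Γ w) from ⟨(saddle_zero Γ).trans_lt h0, hw⟩)
    exact ⟨v, hv.1, hve⟩

theorem existsUnique_saddle_eq (hΓ : IsProperDegreeDist Γ) {e : ℝ}
    (he : e ∈ Ioo 0 (maxFraction Γ)) : ∃! v, 0 < v ∧ saddle Γ v = e := by
  obtain ⟨v, hv, hve⟩ := hΓ.exists_saddle_eq_iff.2 he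
  exact ⟨v, ⟨hv, hve⟩, fun w hw =>
    hΓ.saddle_strictMonoOn.injOn hw.1.le hv.le (hw.2.trans hve.symm)⟩

theorem saddleRoot_spec (hΓ : IsProperDegreeDist Γ) {e : ℝ} (he : e ∈ Ioo 0 (maxFraction Γ)) :
    0 < saddleRoot Γ e ∧ saddle Γ (saddleRoot Γ e) = e := by
  have h := hΓ.exists_saddle_eq_iff.2 he
  rw [saddleRoot, dif_pos h]
  exact h.choose_spec

theorem saddleRoot_saddle (hΓ : IsProperDegreeDist Γ) {v : ℝ} (hv : 0 < v) :
    saddleRoot Γ (saddle Γ v) = v := by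
  obtain ⟨hpos, hroot⟩ := hΓ.saddleRoot_spec (hΓ.exists_saddle_eq_iff.1 ⟨v, hv, rfl⟩)
  exact hΓ.saddle_strictMonoOn.injOn hpos.le hv.le hroot

theorem saddleRoot_monotoneOn (hΓ : IsProperDegreeDist Γ) :
    MonotoneOn (saddleRoot Γ) (Ioo 0 (maxFraction Γ)) := by
  intro e he e' he' h
  obtain ⟨hpos, hroot⟩ := hΓ.saddleRoot_spec he
  obtain ⟨hpos', hroot'⟩ := hΓ.saddleRoot_spec he'
  rwa [← hΓ.saddle_strictMonoOn.le_iff_le hpos.le hpos'.le, hroot, hroot']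

end IsProperDegreeDist

theorem thetaDomain_eq {Γ₁ Γ₂ : ℝ[X]} (h₁ : IsProperDegreeDist Γ₁) (h₂ : IsProperDegreeDist Γ₂) :
    thetaDomain Γ₁ Γ₂ = Ioo 0 (min (maxFraction Γ₁) (maxFraction Γ₂)) := by
  ext e
  simp only [thetaDomain, mem_ofPred_eq, h₁.exists_saddle_eq_iff, h₂.exists_saddle_eq_iff, mem_Ioo,
    lt_min_iff]
  have hle := h₁.maxFraction_le_one
  constructor
  · rintro ⟨-, ⟨h0, h1⟩, -, h2⟩
    exact ⟨h0, h1, h2⟩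
  · rintro ⟨h0, h1, h2⟩
    exact ⟨⟨h0, h1.trans_le hle⟩, ⟨h0, h1⟩, h0, h2⟩

end SaddlePoint

/-! ### Exponents -/

section Exponents

variable {Γ : ℝ[X]}

/-- The mean of `log (q r v)` for a degree `r` distributed according to `Γ`: the cumulant generating
function, at `log v`, of the number of ones at a check node, up to a constant. -/
noncomputable def meanLogQ (Γ : ℝ[X]) (v : ℝ) : ℝ := Γ.sum fun r g => g * Real.log (q r v)

/-- The exponent (in nats) of the saddle point bound with parameter `v` on the number of even sets
containing a fraction `e` of the check node sockets of one type. -/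
noncomputable def checkExponent (l : ℕ) (Γ : ℝ[X]) (e v : ℝ) : ℝ :=
  l / avgDegree Γ * meanLogQ Γ v - e * l * Real.log v

/-- The exponent (in nats) of the expected number of codewords of relative weight `e`, as a function
of the two saddle point parameters. -/
noncomputable def exponent (l₁ l₂ : ℕ) (Γ₁ Γ₂ : ℝ[X]) (e v₁ v₂ : ℝ) : ℝ :=
  (1 - l₁ - l₂) * Real.binEntropy e + checkExponent l₁ Γ₁ e v₁ + checkExponent l₂ Γ₂ e v₂

theorem checkExponent_one (l : ℕ) (Γ : ℝ[X]) (e : ℝ) :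
    checkExponent l Γ e 1 = l / avgDegree Γ * meanLogQ Γ 1 := by
  rw [checkExponent, Real.log_one, mul_zero, sub_zero]

theorem checkExponent_sub (l : ℕ) (Γ : ℝ[X]) (e e' v : ℝ) :
    checkExponent l Γ e v - checkExponent l Γ e' v = (e' - e) * (l * Real.log v) := by
  rw [checkExponent, checkExponent]
  ring

namespace IsProperDegreeDist

theorem hasDerivAt_meanLogQ_exp (hΓ : IsProperDegreeDist Γ) (t : ℝ) :
    HasDerivAt (fun t => meanLogQ Γ (Real.exp t)) (avgDegree Γ * saddle Γ (Real.exp t)) t := by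
  rw [saddle_eq_sum, mul_div_cancel₀ _ hΓ.avgDegree_pos.ne', Polynomial.sum]
  refine HasDerivAt.fun_sum fun r _ => HasDerivAt.const_mul _ ?_
  have hq := q_pos r (Real.exp_pos t).le
  rw [← eval_evenPoly] at hq
  simpa only [eval_evenPoly] using hasDerivAt_log_eval_exp hq.ne'

theorem hasDerivAt_checkExponent_exp (hΓ : IsProperDegreeDist Γ) (l : ℕ) (e t : ℝ) :
    HasDerivAt (fun t => checkExponent l Γ e (Real.exp t)) (l * (saddle Γ (Real.exp t) - e)) t := by
  simp only [checkExponent, Real.log_exp]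
  refine (((hΓ.hasDerivAt_meanLogQ_exp t).const_mul (l / avgDegree Γ)).sub
    ((hasDerivAt_id t).const_mul (e * l))).congr_deriv ?_
  have := hΓ.avgDegree_pos
  field_simp

theorem convexOn_checkExponent_exp (hΓ : IsProperDegreeDist Γ) (l : ℕ) (e : ℝ) :
    ConvexOn ℝ univ fun t => checkExponent l Γ e (Real.exp t) := by
  refine Monotone.convexOn_univ_of_deriv
    (fun t => (hΓ.hasDerivAt_checkExponent_exp l e t).differentiableAt) ?_
  rw [funext fun t => (hΓ.hasDerivAt_checkExponent_exp l e t).deriv]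
  intro s t hst
  have := hΓ.saddle_strictMonoOn.monotoneOn (Real.exp_pos s).le (Real.exp_pos t).le
    (Real.exp_le_exp.2 hst)
  dsimp only
  gcongr

theorem checkExponent_saddle_le (hΓ : IsProperDegreeDist Γ) (l : ℕ) {u v : ℝ} (hu : 0 < u)
    (hv : 0 < v) : checkExponent l Γ (saddle Γ v) v ≤ checkExponent l Γ (saddle Γ v) u := by
  have hderiv : HasDerivAt (fun t => checkExponent l Γ (saddle Γ v) (Real.exp t)) 0
      (Real.log v) := by
    simpa only [Real.exp_log hv, sub_self, mul_zero] using
      hΓ.hasDerivAt_checkExponent_exp l (saddle Γ v) (Real.log v)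
  have hmin := (hΓ.convexOn_checkExponent_exp l (saddle Γ v)).isMinOn_of_rightDeriv_eq_zero
    (by rw [interior_univ]; exact mem_univ _)
    (hderiv.hasDerivWithinAt.derivWithin (uniqueDiffWithinAt_Ioi _))
  simpa only [Real.exp_log hu, Real.exp_log hv] using isMinOn_univ_iff.1 hmin (Real.log u)

theorem meanLogQ_le (hΓ : IsProperDegreeDist Γ) {v : ℝ} (hv : 1 ≤ v) :
    meanLogQ Γ v ≤ meanLogQ Γ 1 + avgDegree Γ * maxFraction Γ * Real.log v := by
  rw [hΓ.maxFraction_eq_sum, mul_div_cancel₀ _ hΓ.avgDegree_pos.ne', meanLogQ, meanLogQ,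
    Polynomial.sum, Polynomial.sum, Polynomial.sum, Finset.sum_mul, ← Finset.sum_add_distrib]
  refine Finset.sum_le_sum fun r _ => ?_
  rw [mul_assoc, ← mul_add]
  refine mul_le_mul_of_nonneg_left ?_ (hΓ.nonneg r)
  have hv0 : 0 < v := one_pos.trans_le hv
  rw [← Real.log_pow, ← Real.log_mul (q_pos r zero_le_one).ne' (pow_pos hv0 _).ne']
  refine Real.log_le_log (q_pos r hv0.le) ?_
  simpa only [eval_evenPoly] using (coeffNonneg_evenPoly r).eval_le_eval_one_mul_pow hv

theorem tendsto_checkExponent_atTop (hΓ : IsProperDegreeDist Γ) {l : ℕ} (hl : 0 < l) {e : ℝ}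
    (he : maxFraction Γ < e) : Tendsto (checkExponent l Γ e) atTop atBot := by
  have hneg : (l : ℝ) * (maxFraction Γ - e) < 0 :=
    mul_neg_of_pos_of_neg (Nat.cast_pos.2 hl) (sub_neg.2 he)
  refine tendsto_atBot_mono' _ ?_ (tendsto_atBot_add_const_left _
    (l / avgDegree Γ * meanLogQ Γ 1) (Real.tendsto_log_atTop.const_mul_atTop_of_neg hneg))
  filter_upwards [eventually_ge_atTop 1] with v hv
  have hA := hΓ.avgDegree_pos
  have h := mul_le_mul_of_nonneg_left (hΓ.meanLogQ_le hv) (by positivity : 0 ≤ l / avgDegree Γ)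
  rw [checkExponent]
  calc l / avgDegree Γ * meanLogQ Γ v - e * l * Real.log v
      ≤ l / avgDegree Γ * (meanLogQ Γ 1 + avgDegree Γ * maxFraction Γ * Real.log v)
        - e * l * Real.log v := sub_le_sub_right h _
    _ = l / avgDegree Γ * meanLogQ Γ 1 + l * (maxFraction Γ - e) * Real.log v := by
      field_simp
      ring

end IsProperDegreeDist

end Exponents

/-! ### Binomial coefficients and entropy -/

section Entropy

variable {n w : ℕ}

theorem choose_mul_pow_mul_pow_le (hw : w < n) {i : ℕ} (hi : i ≤ n) :
    n.choose i * w ^ i * (n - w) ^ (n - i) ≤ n.choose w * w ^ w * (n - w) ^ (n - w) := by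
  set S : ℕ → ℕ := fun i => n.choose i * w ^ i * (n - w) ^ (n - i) with hS
  have hstep : ∀ i < n, S (i + 1) * ((i + 1) * (n - w)) = S i * ((n - i) * w) := by
    intro i hi
    calc S (i + 1) * ((i + 1) * (n - w))
        = (n.choose (i + 1) * (i + 1)) * w ^ (i + 1) * (n - w) ^ (n - (i + 1) + 1) := by
          simp only [hS]
          ring
      _ = S i * ((n - i) * w) := by
          rw [Nat.choose_succ_right_eq, show n - (i + 1) + 1 = n - i by lia]
          simp only [hS]
          ring
  have hpos : ∀ i, 0 < (i + 1) * (n - w) := fun i => Nat.mul_pos i.succ_pos (Nat.sub_pos_of_lt hw)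
  have hup : MonotoneOn S (Iic w) := by
    refine monotoneOn_of_le_add_one ordConnected_Iic fun i _ _ hi => ?_
    have hi : i + 1 ≤ w := hi
    refine Nat.le_of_mul_le_mul_right ?_ (hpos i)
    rw [hstep i (by lia), mul_comm (n - i)]
    exact Nat.mul_le_mul_left _ (Nat.mul_le_mul hi (by lia))
  have hdown : AntitoneOn S (Icc w n) := by
    refine antitoneOn_of_add_one_le ordConnected_Icc fun i _ hi hi' => ?_
    refine Nat.le_of_mul_le_mul_right ?_ (hpos i)
    rw [hstep i hi'.2, mul_comm (n - i)]
    exact Nat.mul_le_mul_left _ (Nat.mul_le_mul (hi.1.trans i.le_succ) (Nat.sub_le_sub_left hi.1 n))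
  obtain h | h := le_total i w
  · exact hup h self_mem_Iic h
  · exact hdown ⟨le_rfl, hw.le⟩ ⟨h, hi⟩ h

theorem exp_mul_log_inv_mul_pow (hw : w ≤ n) :
    Real.exp (w * Real.log (w / n : ℝ)⁻¹) * w ^ w = (n : ℝ) ^ w := by
  obtain rfl | hw0 := Nat.eq_zero_or_pos w
  · simp
  have hw' : (0 : ℝ) < w := Nat.cast_pos.2 hw0
  have hn' : (0 : ℝ) < n := Nat.cast_pos.2 (hw0.trans_le hw)
  rw [← Real.log_pow, Real.exp_log (by positivity), ← mul_pow, inv_div, div_mul_cancel₀ _ hw'.ne']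

theorem exp_mul_binEntropy_mul_pow_mul_pow (hw : w ≤ n) :
    Real.exp (n * Real.binEntropy (w / n)) * (w ^ w * ((n - w : ℕ) : ℝ) ^ (n - w)) = n ^ n := by
  obtain rfl | hn := Nat.eq_zero_or_pos n
  · simp [Nat.le_zero.1 hw]
  have hn' : (n : ℝ) ≠ 0 := Nat.cast_ne_zero.2 hn.ne'
  have hsplit : n * Real.binEntropy (w / n) =
      w * Real.log (w / n : ℝ)⁻¹ + (n - w : ℕ) * Real.log ((n - w : ℕ) / n : ℝ)⁻¹ := by
    rw [Real.binEntropy, Nat.cast_sub hw, sub_div, div_self hn', mul_add, ← mul_assoc, ← mul_assoc,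
      mul_sub, mul_div_cancel₀ _ hn', mul_one]
  rw [hsplit, Real.exp_add, mul_mul_mul_comm, exp_mul_log_inv_mul_pow hw,
    exp_mul_log_inv_mul_pow (Nat.sub_le n w), ← pow_add, Nat.add_sub_cancel' hw]

theorem choose_mul_pow_mul_pow_le_pow (hw : w ≤ n) :
    n.choose w * (w ^ w * (n - w) ^ (n - w)) ≤ n ^ n := by
  have hsum := add_pow w (n - w) n
  rw [Nat.add_sub_cancel' hw] at hsum
  rw [hsum, mul_comm]
  exact Finset.single_le_sum (f := fun i => w ^ i * (n - w) ^ (n - i) * n.choose i)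
    (fun _ _ => Nat.zero_le _) (Finset.mem_range_succ_iff.2 hw)

theorem pow_le_mul_choose_mul_pow_mul_pow (hw : w < n) :
    n ^ n ≤ (n + 1) * n.choose w * (w ^ w * (n - w) ^ (n - w)) := by
  have hsum := add_pow w (n - w) n
  rw [Nat.add_sub_cancel' hw.le] at hsum
  rw [hsum]
  refine (Finset.sum_le_card_nsmul _ _ (n.choose w * w ^ w * (n - w) ^ (n - w))
    fun i hi => ?_).trans_eq ?_
  · rw [mul_comm, ← mul_assoc]
    exact choose_mul_pow_mul_pow_le hw (Finset.mem_range_succ_iff.1 hi)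
  · rw [Finset.card_range, smul_eq_mul]
    ring

theorem choose_le_exp_mul_binEntropy (hw : w ≤ n) :
    (n.choose w : ℝ) ≤ Real.exp (n * Real.binEntropy (w / n)) := by
  have hpos : (0 : ℝ) < w ^ w * ((n - w : ℕ) : ℝ) ^ (n - w) :=
    mod_cast Nat.mul_pos Nat.pow_self_pos Nat.pow_self_pos
  rw [← mul_le_mul_iff_left₀ hpos, exp_mul_binEntropy_mul_pow_mul_pow hw]
  exact_mod_cast choose_mul_pow_mul_pow_le_pow hw

theorem exp_mul_binEntropy_le (hw : w ≤ n) :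
    Real.exp (n * Real.binEntropy (w / n)) ≤ (n + 1) * n.choose w := by
  obtain rfl | hw' := hw.eq_or_lt
  · obtain rfl | hw0 := eq_or_ne w 0 <;> simp [*]
  have hpos : (0 : ℝ) < w ^ w * ((n - w : ℕ) : ℝ) ^ (n - w) :=
    mod_cast Nat.mul_pos Nat.pow_self_pos Nat.pow_self_pos
  rw [← mul_le_mul_iff_left₀ hpos, exp_mul_binEntropy_mul_pow_mul_pow hw]
  exact_mod_cast pow_le_mul_choose_mul_pow_mul_pow hw'

theorem binEntropy₂_eq_div (x : ℝ) : binEntropy₂ x = Real.binEntropy x / Real.log 2 := by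
  rw [binEntropy₂, Real.binEntropy, Real.logb, Real.logb, Real.log_inv, Real.log_inv]
  ring

end Entropy

/-! ### Exponential growth rates -/

section Growth

/-- The sequence `a` grows at most exponentially with rate `A` (in nats) in the block length `n`.
This encodes `limsup log (a k) / n k ≤ A` without a logarithm, as `a` may vanish. -/
def GrowthLE (n : ℕ → ℕ) (a : ℕ → ℝ) (A : ℝ) : Prop :=
  ∀ b > A, ∀ᶠ k in atTop, a k ≤ Real.exp (n k * b)

/-- The sequence `a` grows at least exponentially with rate `A` (in nats) in the block length
`n`. -/
def GrowthGE (n : ℕ → ℕ) (a : ℕ → ℝ) (A : ℝ) : Prop :=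
  ∀ b < A, ∀ᶠ k in atTop, Real.exp (n k * b) ≤ a k

variable {n : ℕ → ℕ} {a b c : ℕ → ℝ} {A B : ℝ}

theorem GrowthLE.of_le_exp (h : ∀ᶠ k in atTop, a k ≤ Real.exp (n k * c k))
    (hc : Tendsto c atTop (𝓝 A)) : GrowthLE n a A := by
  intro y hy
  filter_upwards [h, hc.eventually_lt_const hy] with k hk hck
  exact hk.trans (by gcongr)

theorem GrowthGE.of_exp_le (h : ∀ᶠ k in atTop, Real.exp (n k * c k) ≤ a k)
    (hc : Tendsto c atTop (𝓝 A)) : GrowthGE n a A := by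
  intro y hy
  filter_upwards [h, hc.eventually_const_lt hy] with k hk hck
  exact le_trans (by gcongr) hk

theorem GrowthLE.mono (hb : GrowthLE n b A) (h : ∀ k, a k ≤ b k) : GrowthLE n a A :=
  fun y hy => (hb y hy).mono fun k hk => (h k).trans hk

theorem GrowthGE.mono (ha : GrowthGE n a A) (h : ∀ k, a k ≤ b k) : GrowthGE n b A :=
  fun y hy => (ha y hy).mono fun k hk => hk.trans (h k)

theorem GrowthLE.mul (ha : GrowthLE n a A) (hb : GrowthLE n b B) (hb0 : ∀ k, 0 ≤ b k) :
    GrowthLE n (fun k => a k * b k) (A + B) := by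
  intro y hy
  filter_upwards [ha (A + (y - (A + B)) / 2) (by linarith),
    hb (B + (y - (A + B)) / 2) (by linarith)] with k hka hkb
  calc a k * b k ≤ Real.exp (n k * (A + (y - (A + B)) / 2)) *
        Real.exp (n k * (B + (y - (A + B)) / 2)) :=
        mul_le_mul hka hkb (hb0 k) (Real.exp_pos _).le
    _ = Real.exp (n k * y) := by
      rw [← Real.exp_add]
      ring_nf

theorem GrowthGE.mul (ha : GrowthGE n a A) (hb : GrowthGE n b B) :
    GrowthGE n (fun k => a k * b k) (A + B) := by
  intro y hy
  filter_upwards [ha (A - ((A + B) - y) / 2) (by linarith),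
    hb (B - ((A + B) - y) / 2) (by linarith)] with k hka hkb
  calc Real.exp (n k * y) = Real.exp (n k * (A - ((A + B) - y) / 2)) *
        Real.exp (n k * (B - ((A + B) - y) / 2)) := by
        rw [← Real.exp_add]
        ring_nf
    _ ≤ a k * b k := mul_le_mul hka hkb (Real.exp_pos _).le ((Real.exp_pos _).le.trans hka)

theorem GrowthLE.inv (ha : GrowthLE n a A) (ha0 : ∀ k, 0 < a k) :
    GrowthGE n (fun k => (a k)⁻¹) (-A) := by
  intro y hy
  filter_upwards [ha (-y) (lt_neg_of_lt_neg hy)] with k hk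
  rw [← neg_neg y, mul_neg, Real.exp_neg]
  exact inv_anti₀ (ha0 k) hk

theorem GrowthGE.inv (ha : GrowthGE n a A) : GrowthLE n (fun k => (a k)⁻¹) (-A) := by
  intro y hy
  filter_upwards [ha (-y) (neg_lt_of_neg_lt hy)] with k hk
  rw [← neg_neg y, mul_neg, Real.exp_neg]
  exact inv_anti₀ (Real.exp_pos _) hk

theorem tendsto_log_div_of_growth (hn : Tendsto n atTop atTop) (hle : GrowthLE n a A)
    (hge : GrowthGE n a A) : Tendsto (fun k => Real.log (a k) / n k) atTop (𝓝 A) := by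
  refine tendsto_order.2 ⟨fun y hy => ?_, fun y hy => ?_⟩
  · obtain ⟨z, hyz, hzA⟩ := exists_between hy
    filter_upwards [hge z hzA, hn.eventually_gt_atTop 0] with k hk hnk
    rw [lt_div_iff₀ (Nat.cast_pos.2 hnk), mul_comm]
    exact (mul_lt_mul_of_pos_left hyz (Nat.cast_pos.2 hnk)).trans_le
      ((Real.le_log_iff_exp_le ((Real.exp_pos _).trans_le hk)).2 hk)
  · obtain ⟨z, hAz, hzy⟩ := exists_between hy
    filter_upwards [hle z hAz, hge (A - 1) (by linarith), hn.eventually_gt_atTop 0]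
      with k hk hpos hnk
    rw [div_lt_iff₀ (Nat.cast_pos.2 hnk), mul_comm y]
    exact ((Real.log_le_iff_le_exp ((Real.exp_pos _).trans_le hpos)).2 hk).trans_lt
      (mul_lt_mul_of_pos_left hzy (Nat.cast_pos.2 hnk))

theorem eventually_exp_mul_log_div (hn : Tendsto n atTop atTop) (ha : ∀ k, 0 < a k) :
    ∀ᶠ k in atTop, Real.exp (n k * (Real.log (a k) / n k)) = a k := by
  filter_upwards [hn.eventually_gt_atTop 0] with k hk
  rw [mul_div_cancel₀ _ (Nat.cast_ne_zero.2 hk.ne'), Real.exp_log (ha k)]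

theorem GrowthLE.of_tendsto_log_div (hn : Tendsto n atTop atTop) (ha : ∀ k, 0 < a k)
    (h : Tendsto (fun k => Real.log (a k) / n k) atTop (𝓝 A)) : GrowthLE n a A :=
  GrowthLE.of_le_exp ((eventually_exp_mul_log_div hn ha).mono fun _ hk => hk.ge) h

theorem GrowthGE.of_tendsto_log_div (hn : Tendsto n atTop atTop) (ha : ∀ k, 0 < a k)
    (h : Tendsto (fun k => Real.log (a k) / n k) atTop (𝓝 A)) : GrowthGE n a A :=
  GrowthGE.of_exp_le ((eventually_exp_mul_log_div hn ha).mono fun _ hk => hk.le) h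

theorem tendsto_log_mul_add_one_div (hn : Tendsto n atTop atTop) (l : ℕ) :
    Tendsto (fun k => Real.log ((n k * l : ℕ) + 1) / n k) atTop (𝓝 0) := by
  have hnR : Tendsto (fun k => (n k : ℝ)) atTop atTop := tendsto_natCast_atTop_atTop.comp hn
  have hlim : Tendsto (fun k => Real.log (l + 1) / n k + Real.log (n k) / n k) atTop (𝓝 (0 + 0)) :=
    (hnR.const_div_atTop _).add (Real.isLittleO_log_id_atTop.tendsto_div_nhds_zero.comp hnR)
  rw [add_zero] at hlim
  refine squeeze_zero' (Eventually.of_forall fun k => div_nonneg (Real.log_nonneg ?_)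
    (Nat.cast_nonneg _)) ?_ hlim
  · exact le_add_of_nonneg_left (Nat.cast_nonneg _)
  · filter_upwards [hn.eventually_ge_atTop 1] with k hk
    have hk : (1 : ℝ) ≤ n k := Nat.one_le_cast.2 hk
    rw [← add_div, ← Real.log_mul (by positivity) (by positivity)]
    gcongr
    push_cast
    linarith

theorem growthLE_mul_add_one (hn : Tendsto n atTop atTop) (l : ℕ) :
    GrowthLE n (fun k => ((n k * l : ℕ) : ℝ) + 1) 0 :=
  GrowthLE.of_tendsto_log_div hn (fun _ => by positivity) (tendsto_log_mul_add_one_div hn l)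

section Pow

variable {x y : ℝ} {m : ℕ → ℕ}

theorem tendsto_log_pow_div (x : ℝ) (hm : Tendsto (fun k => (m k : ℝ) / n k) atTop (𝓝 y)) :
    Tendsto (fun k => Real.log (x ^ m k) / n k) atTop (𝓝 (y * Real.log x)) := by
  simpa only [Real.log_pow, mul_div_right_comm] using hm.mul_const (Real.log x)

theorem growthLE_pow (hn : Tendsto n atTop atTop) (hx : 0 < x)
    (hm : Tendsto (fun k => (m k : ℝ) / n k) atTop (𝓝 y)) :
    GrowthLE n (fun k => x ^ m k) (y * Real.log x) :=
  GrowthLE.of_tendsto_log_div hn (fun _ => pow_pos hx _) (tendsto_log_pow_div x hm)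

theorem growthGE_pow (hn : Tendsto n atTop atTop) (hx : 0 < x)
    (hm : Tendsto (fun k => (m k : ℝ) / n k) atTop (𝓝 y)) :
    GrowthGE n (fun k => x ^ m k) (y * Real.log x) :=
  GrowthGE.of_tendsto_log_div hn (fun _ => pow_pos hx _) (tendsto_log_pow_div x hm)

end Pow

section Choose

variable {w : ℕ → ℕ} {e : ℝ}

theorem tendsto_mul_binEntropy (l : ℕ) (he : Tendsto (fun k => (w k : ℝ) / n k) atTop (𝓝 e)) :
    Tendsto (fun k => l * Real.binEntropy ((w k : ℝ) / n k)) atTop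
      (𝓝 (l * Real.binEntropy e)) :=
  ((Real.binEntropy_continuous.tendsto e).comp he).const_mul _

theorem mul_mul_binEntropy_div (n w l : ℕ) :
    (n * l : ℕ) * Real.binEntropy ((w * l : ℕ) / (n * l : ℕ)) =
      n * (l * Real.binEntropy ((w : ℝ) / n)) := by
  obtain rfl | hl := eq_or_ne l 0
  · simp
  rw [Nat.cast_mul, Nat.cast_mul, mul_div_mul_right _ _ (Nat.cast_ne_zero.2 hl), mul_assoc]

theorem growthLE_choose (l : ℕ) (hw : ∀ k, w k ≤ n k)
    (he : Tendsto (fun k => (w k : ℝ) / n k) atTop (𝓝 e)) :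
    GrowthLE n (fun k => ((n k * l).choose (w k * l) : ℝ)) (l * Real.binEntropy e) := by
  refine GrowthLE.of_le_exp (Eventually.of_forall fun k => ?_) (tendsto_mul_binEntropy l he)
  rw [← mul_mul_binEntropy_div]
  exact choose_le_exp_mul_binEntropy (Nat.mul_le_mul_right l (hw k))

theorem growthGE_choose (hn : Tendsto n atTop atTop) (l : ℕ) (hw : ∀ k, w k ≤ n k)
    (he : Tendsto (fun k => (w k : ℝ) / n k) atTop (𝓝 e)) :
    GrowthGE n (fun k => ((n k * l).choose (w k * l) : ℝ)) (l * Real.binEntropy e) := by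
  have hexp : GrowthGE n (fun k => Real.exp (n k * (l * Real.binEntropy ((w k : ℝ) / n k))))
      (l * Real.binEntropy e) :=
    GrowthGE.of_exp_le (Eventually.of_forall fun _ => le_rfl) (tendsto_mul_binEntropy l he)
  have hprod := hexp.mul ((growthLE_mul_add_one hn l).inv fun _ => by positivity)
  rw [neg_zero, add_zero] at hprod
  refine hprod.mono fun k => ?_
  rw [← mul_mul_binEntropy_div, ← div_eq_mul_inv, div_le_iff₀ (by positivity), mul_comm _ (_ + _)]
  exact exp_mul_binEntropy_le (Nat.mul_le_mul_right l (hw k))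

end Choose

end Growth

/-! ### The growth rate of the number of even sets -/

section EvenCountGrowth

theorem tendsto_of_forall_mul_sub_lt {f : ℝ → ℝ} {f' t : ℝ} (hf : HasDerivAt f f' t) {x : ℕ → ℝ}
    (h : ∀ s, ∀ y > f s - f t, ∀ᶠ k in atTop, x k * (s - t) < y) :
    Tendsto x atTop (𝓝 f') := by
  have hslope := hasDerivAt_iff_tendsto_slope.1 hf
  refine tendsto_order.2 ⟨fun y hy => ?_, fun y hy => ?_⟩
  · obtain ⟨s, hys, hst⟩ := (((hslope.mono_left (nhdsLT_le_nhdsNE t)).eventually_const_lt hy).and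
      self_mem_nhdsWithin).exists
    have hst : s - t < 0 := sub_neg.2 hst
    rw [slope_def_field, lt_div_iff_of_neg hst] at hys
    exact (h s _ hys).mono fun k hk => (mul_lt_mul_right_of_neg hst).1 hk
  · obtain ⟨s, hys, hst⟩ := (((hslope.mono_left (nhdsGT_le_nhdsNE t)).eventually_lt_const hy).and
      self_mem_nhdsWithin).exists
    have hst : 0 < s - t := sub_pos.2 hst
    rw [slope_def_field, div_lt_iff₀ hst] at hys
    exact (h s _ hys).mono fun k hk => (mul_lt_mul_iff_left₀ hst).1 hk

theorem prod_q_pow_pos (M : ℕ →₀ ℕ) {v : ℝ} (hv : 0 ≤ v) : 0 < M.prod fun r m => q r v ^ m :=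
  Finset.prod_pos fun r _ => pow_pos (q_pos r hv) _

theorem log_prod_q_pow (M : ℕ →₀ ℕ) {v : ℝ} (hv : 0 ≤ v) :
    Real.log (M.prod fun r m => q r v ^ m) = M.sum fun r m => m * Real.log (q r v) := by
  rw [Finsupp.prod, Real.log_prod fun r _ => (pow_pos (q_pos r hv) _).ne']
  simp only [Real.log_pow, Finsupp.sum]

theorem two_mul_mul_log_sub_log_le {M : ℕ →₀ ℕ} {c u v : ℝ} {j : ℕ} (hu : 0 < u) (hv : 0 < v)
    (hc : 0 < c)
    (hj : (M.prod fun r m => q r v ^ m) ≤ c * (evenCount M (2 * j) * v ^ (2 * j))) :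
    (2 * j : ℕ) * (Real.log u - Real.log v) ≤ Real.log (M.prod fun r m => q r u ^ m) -
      Real.log (M.prod fun r m => q r v ^ m) + Real.log c := by
  have hPu := prod_q_pow_pos M hu.le
  have hPv := prod_q_pow_pos M hv.le
  have hmul : (M.prod fun r m => q r v ^ m) * u ^ (2 * j) ≤
      c * ((M.prod fun r m => q r u ^ m) * v ^ (2 * j)) := by
    calc (M.prod fun r m => q r v ^ m) * u ^ (2 * j)
        ≤ c * (evenCount M (2 * j) * v ^ (2 * j)) * u ^ (2 * j) := by gcongr
      _ = c * (evenCount M (2 * j) * u ^ (2 * j) * v ^ (2 * j)) := by ring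
      _ ≤ _ := by
        gcongr
        exact evenCount_mul_pow_le M _ hu.le
  have hlog := Real.log_le_log (by positivity) hmul
  rw [Real.log_mul hPv.ne' (by positivity), Real.log_mul hc.ne' (by positivity),
    Real.log_mul hPu.ne' (by positivity), Real.log_pow, Real.log_pow] at hlog
  linarith

namespace FollowsDegreeDist

variable {l : ℕ} {Γ : ℝ[X]} {n : ℕ → ℕ} {M : ℕ → ℕ →₀ ℕ}

theorem comp (hM : FollowsDegreeDist l Γ n M) {φ : ℕ → ℕ} (hφ : Tendsto φ atTop atTop) :
    FollowsDegreeDist l Γ (n ∘ φ) (M ∘ φ) where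
  edges k := hM.edges (φ k)
  support k := hM.support (φ k)
  tendsto r := (hM.tendsto r).comp hφ

theorem tendsto_sum_div (hM : FollowsDegreeDist l Γ n M) (f : ℕ → ℝ) :
    Tendsto (fun k => ((M k).sum fun r m => m * f r) / n k) atTop
      (𝓝 (l / avgDegree Γ * Γ.sum fun r g => g * f r)) := by
  have hsum : ∀ k, ((M k).sum fun r m => m * f r) / n k =
      ∑ r ∈ Γ.support, (M k r : ℝ) / n k * f r := by
    intro k
    rw [Finsupp.sum_of_support_subset _ (hM.support k) _ fun r _ => by simp, Finset.sum_div]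
    exact Finset.sum_congr rfl fun r _ => mul_div_right_comm _ _ _
  have hlim : l / avgDegree Γ * (Γ.sum fun r g => g * f r) =
      ∑ r ∈ Γ.support, Γ.coeff r * l / avgDegree Γ * f r := by
    rw [Polynomial.sum, Finset.mul_sum]
    exact Finset.sum_congr rfl fun r _ => by ring
  simp only [hsum, hlim]
  exact tendsto_finsetSum _ fun r _ => (hM.tendsto r).mul_const _

theorem tendsto_log_prod_q_div (hM : FollowsDegreeDist l Γ n M) {v : ℝ} (hv : 0 ≤ v) :
    Tendsto (fun k => Real.log ((M k).prod fun r m => q r v ^ m) / n k) atTop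
      (𝓝 (l / avgDegree Γ * meanLogQ Γ v)) := by
  simpa only [log_prod_q_pow _ hv, meanLogQ] using hM.tendsto_sum_div fun r => Real.log (q r v)

theorem tendsto_maxEvenSize_div (hM : FollowsDegreeDist l Γ n M) (hΓ : IsProperDegreeDist Γ) :
    Tendsto (fun k => (maxEvenSize (M k) : ℝ) / n k) atTop (𝓝 (l * maxFraction Γ)) := by
  have hlim := hM.tendsto_sum_div fun r => ((2 * (r / 2) : ℕ) : ℝ)
  simp only [← natDegree_evenPoly] at hlim
  rw [hΓ.maxFraction_eq_sum, mul_div_assoc', mul_div_right_comm]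
  refine hlim.congr fun k => ?_
  rw [maxEvenSize, Finsupp.sum, Finsupp.sum, Nat.cast_sum]
  simp only [Nat.cast_mul, natDegree_evenPoly]

theorem growthLE_evenCount (hM : FollowsDegreeDist l Γ n M) (hn : Tendsto n atTop atTop)
    {s : ℕ → ℕ} {e v : ℝ} (hv : 0 < v)
    (hs : Tendsto (fun k => (s k : ℝ) / n k) atTop (𝓝 (e * l))) :
    GrowthLE n (fun k => (evenCount (M k) (s k) : ℝ)) (checkExponent l Γ e v) := by
  have hprod := (GrowthLE.of_tendsto_log_div hn (fun k => prod_q_pow_pos (M k) hv.le)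
    (hM.tendsto_log_prod_q_div hv.le)).mul (growthLE_pow hn (inv_pos.2 hv) hs)
    fun _ => by positivity
  rw [Real.log_inv, mul_neg, ← sub_eq_add_neg] at hprod
  refine hprod.mono fun k => ?_
  rw [inv_pow, ← div_eq_mul_inv, le_div_iff₀ (pow_pos hv _)]
  exact evenCount_mul_pow_le (M k) (s k) hv.le

section DominantSize

variable {j : ℕ → ℕ} {v : ℝ}

theorem tendsto_dominant_size (hM : FollowsDegreeDist l Γ n M) (hΓ : IsProperDegreeDist Γ)
    (hn : Tendsto n atTop atTop) (hv : 0 < v)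
    (hj : ∀ k, ((M k).prod fun r m => q r v ^ m) ≤
      ((n k * l : ℕ) + 1) * (evenCount (M k) (2 * j k) * v ^ (2 * j k))) :
    Tendsto (fun k => ((2 * j k : ℕ) : ℝ) / n k) atTop (𝓝 (saddle Γ v * l)) := by
  have hderiv : HasDerivAt (fun t => l / avgDegree Γ * meanLogQ Γ (Real.exp t)) (saddle Γ v * l)
      (Real.log v) := by
    have h := (hΓ.hasDerivAt_meanLogQ_exp (Real.log v)).const_mul (l / avgDegree Γ)
    rwa [Real.exp_log hv, div_mul_eq_mul_div, mul_left_comm,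
      mul_div_cancel_left₀ _ hΓ.avgDegree_pos.ne', mul_comm] at h
  refine tendsto_of_forall_mul_sub_lt hderiv fun t y hy => ?_
  have hlim := ((hM.tendsto_log_prod_q_div (Real.exp_pos t).le).sub
    (hM.tendsto_log_prod_q_div hv.le)).add (tendsto_log_mul_add_one_div hn l)
  rw [add_zero] at hlim
  simp only [Real.exp_log hv] at hy
  filter_upwards [hlim.eventually_lt_const hy] with k hk
  refine lt_of_le_of_lt ?_ hk
  have h := two_mul_mul_log_sub_log_le (Real.exp_pos t) hv (by positivity) (hj k)
  rw [Real.log_exp] at h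
  rw [div_mul_eq_mul_div, ← sub_div, ← add_div]
  gcongr

theorem growthGE_evenCount_dominant_size (hM : FollowsDegreeDist l Γ n M)
    (hn : Tendsto n atTop atTop) {e : ℝ} (hv : 0 < v)
    (hj : ∀ k, ((M k).prod fun r m => q r v ^ m) ≤
      ((n k * l : ℕ) + 1) * (evenCount (M k) (2 * j k) * v ^ (2 * j k)))
    (he : Tendsto (fun k => ((2 * j k : ℕ) : ℝ) / n k) atTop (𝓝 (e * l))) :
    GrowthGE n (fun k => (evenCount (M k) (2 * j k) : ℝ)) (checkExponent l Γ e v) := by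
  have hprod := ((GrowthGE.of_tendsto_log_div hn (fun k => prod_q_pow_pos (M k) hv.le)
    (hM.tendsto_log_prod_q_div hv.le)).mul ((growthLE_mul_add_one hn l).inv
      fun _ => by positivity)).mul (growthGE_pow hn (inv_pos.2 hv) he)
  rw [neg_zero, add_zero, Real.log_inv, mul_neg, ← sub_eq_add_neg] at hprod
  refine hprod.mono fun k => ?_
  rw [inv_pow, ← div_eq_mul_inv, ← div_eq_mul_inv, div_le_iff₀ (pow_pos hv _),
    div_le_iff₀' (by positivity)]
  exact hj k

end DominantSize

theorem eventually_pow_mul_evenCount_le (hM : FollowsDegreeDist l Γ n M)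
    (hΓ : IsProperDegreeDist Γ) (hn : Tendsto n atTop atTop) {x : ℝ}
    (hx : x ∈ Ioo 0 (l * maxFraction Γ)) {i j : ℕ → ℕ}
    (hi : Tendsto (fun k => ((2 * i k : ℕ) : ℝ) / n k) atTop (𝓝 x))
    (hj : Tendsto (fun k => ((2 * j k : ℕ) : ℝ) / n k) atTop (𝓝 x)) :
    ∃ c : ℝ, 0 < c ∧ ∀ᶠ k in atTop, c ^ (max (i k) (j k) - min (i k) (j k)) *
      (evenCount (M k) (2 * i k) : ℝ) ≤ evenCount (M k) (2 * j k) := by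
  obtain ⟨δ, hδ, hδx, hδS⟩ : ∃ δ > 0, δ < x ∧ x < l * maxFraction Γ - δ := by
    obtain ⟨δ, hδ, hδlt⟩ := exists_between (lt_min hx.1 (sub_pos.2 hx.2))
    exact ⟨δ, hδ, hδlt.trans_le (min_le_left _ _),
      lt_sub_comm.1 (hδlt.trans_le (min_le_right _ _))⟩
  have hS := hM.tendsto_maxEvenSize_div hΓ
  have hdeg : 0 < Γ.natDegree := by
    obtain ⟨r, hr, hr0⟩ := hΓ.exists_two_le
    exact (two_pos.trans_le hr).trans_le (Polynomial.le_natDegree_of_ne_zero hr0)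
  have hC : 0 < l * maxFraction Γ + 1 := by linarith [hx.1, hx.2]
  have hbulk : ∀ {i : ℕ → ℕ}, Tendsto (fun k => ((2 * i k : ℕ) : ℝ) / n k) atTop (𝓝 x) →
      ∀ᶠ k in atTop, (↑(2 * i k) : ℝ) ∈ Icc (δ * n k) (maxEvenSize (M k) - δ * n k) := by
    intro i hi
    filter_upwards [hi.eventually_const_lt hδx, hi.eventually_lt (hS.sub_const δ) hδS,
      hn.eventually_gt_atTop 0] with k hlo hhi hnk
    have hnk : (0 : ℝ) < n k := Nat.cast_pos.2 hnk
    rw [lt_div_iff₀ hnk] at hlo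
    rw [div_lt_iff₀ hnk, sub_mul, div_mul_cancel₀ _ hnk.ne'] at hhi
    exact ⟨hlo.le, hhi.le⟩
  refine ⟨δ / (Γ.natDegree * (l * maxFraction Γ + 1)), by positivity, ?_⟩
  filter_upwards [hbulk hi, hbulk hj, hS.eventually_lt_const (lt_add_one _),
    hn.eventually_gt_atTop 0] with k hik hjk hSk hnk
  have hnk : (0 : ℝ) < n k := Nat.cast_pos.2 hnk
  have h := pow_mul_evenCount_le (R := Γ.natDegree) (fun r hr => Polynomial.le_natDegree_of_mem_supp
    r (hM.support k hr)) (by positivity) ((div_lt_iff₀ hnk).1 hSk).le hik hjk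
  rwa [← mul_assoc, mul_div_mul_right _ _ hnk.ne'] at h

theorem growthGE_evenCount (hM : FollowsDegreeDist l Γ n M) (hΓ : IsProperDegreeDist Γ)
    (hl : 0 < l) (hn : Tendsto n atTop atTop) {i : ℕ → ℕ} {v : ℝ} (hv : 0 < v)
    (hi : Tendsto (fun k => ((2 * i k : ℕ) : ℝ) / n k) atTop (𝓝 (saddle Γ v * l))) :
    GrowthGE n (fun k => (evenCount (M k) (2 * i k) : ℝ)) (checkExponent l Γ (saddle Γ v) v) := by
  have hdom : ∀ k, ∃ j, ((M k).prod fun r m => q r v ^ m) ≤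
      ((n k * l : ℕ) + 1) * (evenCount (M k) (2 * j) * v ^ (2 * j)) := by
    intro k
    rw [← hM.edges k]
    exact exists_prod_q_pow_le (M k) v
  choose j hj using hdom
  have hjlim := hM.tendsto_dominant_size hΓ hn hv hj
  have hl' : (0 : ℝ) < l := Nat.cast_pos.2 hl
  obtain ⟨c, hc, hcomp⟩ := hM.eventually_pow_mul_evenCount_le hΓ hn
    ⟨mul_pos (hΓ.saddle_pos hv) hl', by
      rw [mul_comm]; exact mul_lt_mul_of_pos_left (hΓ.saddle_lt_maxFraction hv.le) hl'⟩ hjlim hi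
  have hdist : Tendsto (fun k => ((max (j k) (i k) - min (j k) (i k) : ℕ) : ℝ) / n k) atTop
      (𝓝 0) := by
    have h := ((hjlim.sub hi).abs).div_const 2
    rw [sub_self, abs_zero, zero_div] at h
    refine h.congr fun k => ?_
    rw [Nat.cast_sub min_le_max, Nat.cast_max, Nat.cast_min, max_sub_min_eq_abs', ← sub_div,
      abs_div, Nat.abs_cast]
    push_cast
    rw [← mul_sub, abs_mul, abs_two]
    ring
  have hprod := (growthGE_pow hn hc hdist).mul
    (hM.growthGE_evenCount_dominant_size hn hv hj hjlim)
  rw [zero_mul, zero_add] at hprod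
  exact fun y hy => by filter_upwards [hprod y hy, hcomp] with k h1 h2 using h1.trans h2

end FollowsDegreeDist

end EvenCountGrowth

/-! ### The growth rate of the expected number of codewords -/

section WeightGrowth

variable {n w : ℕ → ℕ} {e : ℝ}

theorem tendsto_mul_div (l : ℕ) (he : Tendsto (fun k => (w k : ℝ) / n k) atTop (𝓝 e)) :
    Tendsto (fun k => ((w k * l : ℕ) : ℝ) / n k) atTop (𝓝 (e * l)) := by
  simpa only [Nat.cast_mul, mul_div_right_comm] using he.mul_const (l : ℝ)

section EvenProb

variable {l : ℕ} {Γ : ℝ[X]} {M : ℕ → ℕ →₀ ℕ} {v : ℝ}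

theorem FollowsDegreeDist.growthLE_evenProb (hM : FollowsDegreeDist l Γ n M)
    (hn : Tendsto n atTop atTop) (hw : ∀ k, w k ≤ n k)
    (he : Tendsto (fun k => (w k : ℝ) / n k) atTop (𝓝 e)) (hv : 0 < v) :
    GrowthLE n (fun k => evenProb (n k) l (M k) (w k))
      (checkExponent l Γ e v - l * Real.binEntropy e) :=
  (hM.growthLE_evenCount hn hv (tendsto_mul_div l he)).mul (growthGE_choose hn l hw he).inv
    fun _ => by positivity

theorem FollowsDegreeDist.growthGE_evenProb (hM : FollowsDegreeDist l Γ n M)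
    (hΓ : IsProperDegreeDist Γ) (hl : 0 < l) (hn : Tendsto n atTop atTop)
    (hw : ∀ k, w k ≤ n k) (hw2 : ∀ k, Even (w k))
    (he : Tendsto (fun k => (w k : ℝ) / n k) atTop (𝓝 (saddle Γ v))) (hv : 0 < v) :
    GrowthGE n (fun k => evenProb (n k) l (M k) (w k))
      (checkExponent l Γ (saddle Γ v) v - l * Real.binEntropy (saddle Γ v)) := by
  choose i hi using fun k => (hw2 k).mul_right l
  simp only [← two_mul] at hi
  have hcount := hM.growthGE_evenCount hΓ hl hn hv (i := i) (by
    simpa only [hi] using tendsto_mul_div l he)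
  simp only [← hi] at hcount
  exact hcount.mul ((growthLE_choose l hw he).inv fun k =>
    Nat.cast_pos.2 (Nat.choose_pos (Nat.mul_le_mul_right l (hw k))))

end EvenProb

/-- The exponent (in nats) of the expected number of codewords of relative weight `e`, evaluated at
the solutions of the two saddle point equations. -/
noncomputable def saddleExponent (l₁ l₂ : ℕ) (Γ₁ Γ₂ : ℝ[X]) (e : ℝ) : ℝ :=
  exponent l₁ l₂ Γ₁ Γ₂ e (saddleRoot Γ₁ e) (saddleRoot Γ₂ e)

variable {l₁ l₂ : ℕ} {Γ₁ Γ₂ : ℝ[X]} {M₁ M₂ : ℕ → ℕ →₀ ℕ}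

theorem exponent_eq_add_add (l₁ l₂ : ℕ) (Γ₁ Γ₂ : ℝ[X]) (e v₁ v₂ : ℝ) :
    exponent l₁ l₂ Γ₁ Γ₂ e v₁ v₂ = (1 : ℕ) * Real.binEntropy e +
      ((checkExponent l₁ Γ₁ e v₁ - l₁ * Real.binEntropy e) +
        (checkExponent l₂ Γ₂ e v₂ - l₂ * Real.binEntropy e)) := by
  rw [exponent]
  push_cast
  ring

theorem growthLE_expWeightCount (hn : Tendsto n atTop atTop)
    (hM₁ : FollowsDegreeDist l₁ Γ₁ n M₁) (hM₂ : FollowsDegreeDist l₂ Γ₂ n M₂)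
    (hw : ∀ k, w k ≤ n k) (he : Tendsto (fun k => (w k : ℝ) / n k) atTop (𝓝 e))
    {v₁ v₂ : ℝ} (hv₁ : 0 < v₁) (hv₂ : 0 < v₂) :
    GrowthLE n (fun k => expWeightCount (n k) l₁ l₂ (M₁ k) (M₂ k) (w k))
      (exponent l₁ l₂ Γ₁ Γ₂ e v₁ v₂) := by
  have hchoose := growthLE_choose 1 hw he
  simp only [mul_one] at hchoose
  rw [exponent_eq_add_add]
  exact hchoose.mul ((hM₁.growthLE_evenProb hn hw he hv₁).mul
    (hM₂.growthLE_evenProb hn hw he hv₂) fun _ => evenProb_nonneg _ _ _ _)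
    fun _ => mul_nonneg (evenProb_nonneg _ _ _ _) (evenProb_nonneg _ _ _ _)

theorem growthGE_expWeightCount (hΓ₁ : IsProperDegreeDist Γ₁) (hΓ₂ : IsProperDegreeDist Γ₂)
    (hl₁ : 0 < l₁) (hl₂ : 0 < l₂) (hn : Tendsto n atTop atTop)
    (hM₁ : FollowsDegreeDist l₁ Γ₁ n M₁) (hM₂ : FollowsDegreeDist l₂ Γ₂ n M₂)
    (hw : ∀ k, w k ≤ n k) (hw2 : ∀ k, Even (w k))
    (he : Tendsto (fun k => (w k : ℝ) / n k) atTop (𝓝 e)) (heD : e ∈ thetaDomain Γ₁ Γ₂) :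
    GrowthGE n (fun k => expWeightCount (n k) l₁ l₂ (M₁ k) (M₂ k) (w k))
      (saddleExponent l₁ l₂ Γ₁ Γ₂ e) := by
  obtain ⟨-, ⟨v₁, hv₁, rfl⟩, ⟨v₂, hv₂, hv⟩⟩ := heD
  have hprob₂ := hM₂.growthGE_evenProb hΓ₂ hl₂ hn hw hw2 (hv ▸ he) hv₂
  have hchoose := growthGE_choose hn 1 hw he
  simp only [mul_one] at hchoose
  rw [saddleExponent, hΓ₁.saddleRoot_saddle hv₁, exponent_eq_add_add, ← hv,
    hΓ₂.saddleRoot_saddle hv₂, hv]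
  rw [hv] at hprob₂
  exact hchoose.mul ((hM₁.growthGE_evenProb hΓ₁ hl₁ hn hw hw2 he hv₁).mul hprob₂)

theorem exists_even_tendsto_div (hn : Tendsto n atTop atTop) (he : e ∈ Icc (0 : ℝ) 1) :
    ∃ w : ℕ → ℕ, (∀ k, w k ≤ n k) ∧ (∀ k, Even (w k)) ∧
      Tendsto (fun k => (w k : ℝ) / n k) atTop (𝓝 e) := by
  have he2 : 0 ≤ e / 2 := div_nonneg he.1 zero_le_two
  refine ⟨fun k => 2 * ⌊e / 2 * n k⌋₊, fun k => ?_, fun k => even_two_mul _, ?_⟩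
  · have hfloor : (⌊e / 2 * n k⌋₊ : ℝ) ≤ e / 2 * n k := Nat.floor_le (by positivity)
    have : e * n k ≤ n k := mul_le_of_le_one_left (Nat.cast_nonneg _) he.2
    have : (2 : ℝ) * ⌊e / 2 * n k⌋₊ ≤ n k := by linarith
    exact_mod_cast this
  · have hlim := ((tendsto_nat_floor_mul_div_atTop he2).comp
      (tendsto_natCast_atTop_atTop.comp hn)).const_mul 2
    rw [mul_div_cancel₀ e two_ne_zero] at hlim
    refine hlim.congr fun k => ?_
    rw [Nat.cast_mul, mul_div_assoc]
    rfl

theorem growthGE_expNumCodewords (hΓ₁ : IsProperDegreeDist Γ₁) (hΓ₂ : IsProperDegreeDist Γ₂)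
    (hl₁ : 0 < l₁) (hl₂ : 0 < l₂) (hn : Tendsto n atTop atTop)
    (hM₁ : FollowsDegreeDist l₁ Γ₁ n M₁) (hM₂ : FollowsDegreeDist l₂ Γ₂ n M₂)
    (he : e ∈ thetaDomain Γ₁ Γ₂) :
    GrowthGE n (fun k => expNumCodewords (n k) l₁ l₂ (M₁ k) (M₂ k))
      (saddleExponent l₁ l₂ Γ₁ Γ₂ e) := by
  obtain ⟨w, hw, hw2, hlim⟩ := exists_even_tendsto_div hn (Ioo_subset_Icc_self he.1)
  refine (growthGE_expWeightCount hΓ₁ hΓ₂ hl₁ hl₂ hn hM₁ hM₂ hw hw2 hlim he).mono fun k => ?_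
  rw [expNumCodewords_eq_sum (hM₁.edges k) (hM₂.edges k)]
  exact Finset.single_le_sum (f := expWeightCount (n k) l₁ l₂ (M₁ k) (M₂ k))
    (fun _ _ => expWeightCount_nonneg _ _ _ _ _ _) (Finset.mem_range_succ_iff.2 (hw k))

end WeightGrowth

section UpperBound

variable {l₁ l₂ : ℕ} {Γ₁ Γ₂ : ℝ[X]} {e b S : ℝ}

theorem IsProperDegreeDist.checkExponent_saddleRoot_le {Γ : ℝ[X]} (hΓ : IsProperDegreeDist Γ)
    (l : ℕ) {e' e₀ : ℝ} (he' : e' ∈ Ioo 0 (maxFraction Γ)) (he₀ : e₀ ∈ Ioo 0 (maxFraction Γ))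
    (h : e' ∈ uIcc e e₀) :
    checkExponent l Γ e (saddleRoot Γ e') ≤
      checkExponent l Γ e' (saddleRoot Γ e') + (e' - e) * (l * Real.log (saddleRoot Γ e₀)) := by
  rw [← sub_le_iff_le_add', checkExponent_sub]
  have hlog : MonotoneOn (fun x => l * Real.log (saddleRoot Γ x)) (Ioo 0 (maxFraction Γ)) :=
    fun x hx y hy hxy => mul_le_mul_of_nonneg_left
      (Real.log_le_log (hΓ.saddleRoot_spec hx).1 (hΓ.saddleRoot_monotoneOn hx hy hxy))
      (Nat.cast_nonneg l)
  obtain ⟨h1, h2⟩ | ⟨h1, h2⟩ := mem_uIcc.1 h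
  · exact mul_le_mul_of_nonneg_left (hlog he' he₀ h2) (sub_nonneg.2 h1)
  · exact mul_le_mul_of_nonpos_left (hlog he₀ he' h1) (sub_nonpos.2 h2)

theorem exists_mem_Ioo_mem_uIcc {a b x y : ℝ} (hx : x ∈ Icc a b) (hy : y ∈ Ioo a b) {s : Set ℝ}
    (hs : s ∈ 𝓝 x) : ∃ z ∈ s, z ∈ Ioo a b ∧ z ∈ uIcc x y := by
  have hcl : x ∈ closure (openSegment ℝ x y) := by
    rw [closure_openSegment]
    exact left_mem_segment ℝ x y
  obtain ⟨z, hzs, hz⟩ := mem_closure_iff_nhds.1 hcl s hs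
  refine ⟨z, hzs, ?_, segment_eq_uIcc x y ▸ openSegment_subset_segment ℝ x y hz⟩
  rw [← interior_Icc] at hy ⊢
  exact (convex_Icc a b).openSegment_self_interior_subset_interior hx hy hz

theorem exists_exponent_lt_of_mem_Icc (hΓ₁ : IsProperDegreeDist Γ₁) (hΓ₂ : IsProperDegreeDist Γ₂)
    (hS : ∀ e ∈ thetaDomain Γ₁ Γ₂, saddleExponent l₁ l₂ Γ₁ Γ₂ e ≤ S) (hb : S < b)
    (he : e ∈ Icc 0 (min (maxFraction Γ₁) (maxFraction Γ₂))) :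
    ∃ v₁ v₂, 0 < v₁ ∧ 0 < v₂ ∧ exponent l₁ l₂ Γ₁ Γ₂ e v₁ v₂ < b := by
  have hε : 0 < min (maxFraction Γ₁) (maxFraction Γ₂) :=
    lt_min hΓ₁.maxFraction_pos hΓ₂.maxFraction_pos
  obtain ⟨e₀, he₀⟩ := nonempty_Ioo.2 hε
  have hmem₁ : Ioo 0 (min (maxFraction Γ₁) (maxFraction Γ₂)) ⊆ Ioo 0 (maxFraction Γ₁) :=
    Ioo_subset_Ioo_right (min_le_left _ _)
  have hmem₂ : Ioo 0 (min (maxFraction Γ₁) (maxFraction Γ₂)) ⊆ Ioo 0 (maxFraction Γ₂) :=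
    Ioo_subset_Ioo_right (min_le_right _ _)
  set L : ℝ := l₁ * Real.log (saddleRoot Γ₁ e₀) + l₂ * Real.log (saddleRoot Γ₂ e₀)
  have hcont : Continuous fun e' => S + (1 - l₁ - l₂) * (Real.binEntropy e - Real.binEntropy e') +
      (e' - e) * L := by
    have := Real.binEntropy_continuous
    fun_prop
  have hlim := hcont.tendsto e
  simp only [sub_self, mul_zero, zero_mul, add_zero] at hlim
  obtain ⟨e', hlt, hD, hseg⟩ := exists_mem_Ioo_mem_uIcc he he₀ (hlim.eventually_lt_const hb)
  refine ⟨_, _, (hΓ₁.saddleRoot_spec (hmem₁ hD)).1, (hΓ₂.saddleRoot_spec (hmem₂ hD)).1,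
    lt_of_le_of_lt ?_ hlt⟩
  have h₁ := hΓ₁.checkExponent_saddleRoot_le l₁ (hmem₁ hD) (hmem₁ he₀) hseg
  have h₂ := hΓ₂.checkExponent_saddleRoot_le l₂ (hmem₂ hD) (hmem₂ he₀) hseg
  have h := hS e' (by rwa [thetaDomain_eq hΓ₁ hΓ₂])
  rw [saddleExponent, exponent] at h
  rw [exponent]
  linarith

theorem exists_exponent_lt (hΓ₁ : IsProperDegreeDist Γ₁) (hΓ₂ : IsProperDegreeDist Γ₂)
    (hl₁ : 0 < l₁) (hl₂ : 0 < l₂)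
    (hS : ∀ e ∈ thetaDomain Γ₁ Γ₂, saddleExponent l₁ l₂ Γ₁ Γ₂ e ≤ S) (hb : S < b) (he : 0 ≤ e) :
    ∃ v₁ v₂, 0 < v₁ ∧ 0 < v₂ ∧ exponent l₁ l₂ Γ₁ Γ₂ e v₁ v₂ < b := by
  obtain h₁ | h₁ := lt_or_ge (maxFraction Γ₁) e
  · have hlim := tendsto_atBot_add_const_right _ (checkExponent l₂ Γ₂ e 1)
      (tendsto_atBot_add_const_left _ ((1 - l₁ - l₂) * Real.binEntropy e)
        (hΓ₁.tendsto_checkExponent_atTop hl₁ h₁))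
    obtain ⟨v, hvb, hv⟩ := ((hlim.eventually_lt_atBot b).and (eventually_gt_atTop 0)).exists
    exact ⟨v, 1, hv, one_pos, hvb⟩
  obtain h₂ | h₂ := lt_or_ge (maxFraction Γ₂) e
  · have hlim := tendsto_atBot_add_const_left _
      ((1 - l₁ - l₂) * Real.binEntropy e + checkExponent l₁ Γ₁ e 1)
      (hΓ₂.tendsto_checkExponent_atTop hl₂ h₂)
    obtain ⟨v, hvb, hv⟩ := ((hlim.eventually_lt_atBot b).and (eventually_gt_atTop 0)).exists
    exact ⟨1, v, one_pos, hv, hvb⟩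
  exact exists_exponent_lt_of_mem_Icc hΓ₁ hΓ₂ hS hb ⟨he, le_min h₁ h₂⟩

variable {n : ℕ → ℕ} {M₁ M₂ : ℕ → ℕ →₀ ℕ}

theorem eventually_forall_expWeightCount_le (hΓ₁ : IsProperDegreeDist Γ₁)
    (hΓ₂ : IsProperDegreeDist Γ₂) (hl₁ : 0 < l₁) (hl₂ : 0 < l₂) (hn : Tendsto n atTop atTop)
    (hM₁ : FollowsDegreeDist l₁ Γ₁ n M₁) (hM₂ : FollowsDegreeDist l₂ Γ₂ n M₂)
    (hS : ∀ e ∈ thetaDomain Γ₁ Γ₂, saddleExponent l₁ l₂ Γ₁ Γ₂ e ≤ S) (hb : S < b) :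
    ∀ᶠ k in atTop, ∀ w ≤ n k,
      expWeightCount (n k) l₁ l₂ (M₁ k) (M₂ k) w ≤ Real.exp (n k * b) := by
  by_contra hcon
  obtain ⟨φ, hφ, hlarge⟩ := extraction_of_frequently_atTop (not_eventually.1 hcon)
  push Not at hlarge
  choose w hw hlarge using hlarge
  have hmem : ∀ k, (w k : ℝ) / n (φ k) ∈ Icc (0 : ℝ) 1 := fun k =>
    ⟨by positivity, div_le_one_of_le₀ (Nat.cast_le.2 (hw k)) (Nat.cast_nonneg _)⟩
  obtain ⟨e, he, ψ, hψ, hlim⟩ := isCompact_Icc.tendsto_subseq hmem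
  obtain ⟨v₁, v₂, hv₁, hv₂, hv⟩ := exists_exponent_lt hΓ₁ hΓ₂ hl₁ hl₂ hS hb he.1
  have hφψ : Tendsto (φ ∘ ψ) atTop atTop := hφ.tendsto_atTop.comp hψ.tendsto_atTop
  obtain ⟨k, hk⟩ := (growthLE_expWeightCount (hn.comp hφψ) (hM₁.comp hφψ) (hM₂.comp hφψ)
    (w := w ∘ ψ) (fun k => hw (ψ k)) hlim hv₁ hv₂ b hv).exists
  exact (hlarge (ψ k)).not_ge hk

theorem growthLE_expNumCodewords (hΓ₁ : IsProperDegreeDist Γ₁) (hΓ₂ : IsProperDegreeDist Γ₂)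
    (hl₁ : 0 < l₁) (hl₂ : 0 < l₂) (hn : Tendsto n atTop atTop)
    (hM₁ : FollowsDegreeDist l₁ Γ₁ n M₁) (hM₂ : FollowsDegreeDist l₂ Γ₂ n M₂)
    (hS : ∀ e ∈ thetaDomain Γ₁ Γ₂, saddleExponent l₁ l₂ Γ₁ Γ₂ e ≤ S) :
    GrowthLE n (fun k => expNumCodewords (n k) l₁ l₂ (M₁ k) (M₂ k)) S := by
  intro b hb
  obtain ⟨c, hSc, hcb⟩ := exists_between hb
  filter_upwards [eventually_forall_expWeightCount_le hΓ₁ hΓ₂ hl₁ hl₂ hn hM₁ hM₂ hS hSc,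
    growthLE_mul_add_one hn 1 (b - c) (sub_pos.2 hcb)] with k hterm hcard
  rw [expNumCodewords_eq_sum (hM₁.edges k) (hM₂.edges k)]
  calc ∑ w ∈ Finset.range (n k + 1), expWeightCount (n k) l₁ l₂ (M₁ k) (M₂ k) w
      ≤ #(Finset.range (n k + 1)) • Real.exp (n k * c) :=
        Finset.sum_le_card_nsmul _ _ _ fun w hw => hterm w (Finset.mem_range_succ_iff.1 hw)
    _ = ((n k * 1 : ℕ) + 1) * Real.exp (n k * c) := by
      rw [Finset.card_range, nsmul_eq_mul, mul_one, Nat.cast_add_one]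
    _ ≤ Real.exp (n k * (b - c)) * Real.exp (n k * c) := by gcongr
    _ = Real.exp (n k * b) := by
      rw [← Real.exp_add]
      ring_nf

theorem tendsto_log_expNumCodewords_div (hΓ₁ : IsProperDegreeDist Γ₁)
    (hΓ₂ : IsProperDegreeDist Γ₂) (hl₁ : 0 < l₁) (hl₂ : 0 < l₂) (hn : Tendsto n atTop atTop)
    (hM₁ : FollowsDegreeDist l₁ Γ₁ n M₁) (hM₂ : FollowsDegreeDist l₂ Γ₂ n M₂)
    (hS : IsLUB (saddleExponent l₁ l₂ Γ₁ Γ₂ '' thetaDomain Γ₁ Γ₂) S) :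
    Tendsto (fun k => Real.log (expNumCodewords (n k) l₁ l₂ (M₁ k) (M₂ k)) / n k) atTop
      (𝓝 S) := by
  refine tendsto_log_div_of_growth hn (growthLE_expNumCodewords hΓ₁ hΓ₂ hl₁ hl₂ hn hM₁ hM₂
    fun e he => hS.1 (mem_image_of_mem _ he)) fun b hb => ?_
  obtain ⟨_, ⟨e, he, rfl⟩, hbe, -⟩ := hS.exists_between hb
  exact growthGE_expNumCodewords hΓ₁ hΓ₂ hl₁ hl₂ hn hM₁ hM₂ he b hbe

end UpperBound

/-! ### Concentration of the rate -/

section Concentration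

theorem numCodewords_pos {n l₁ l₂ : ℕ} {M₁ M₂ : ℕ →₀ ℕ} (G : TannerGraph n l₁ l₂ M₁ M₂) :
    0 < numCodewords G := by
  rw [numCodewords, Set.ncard_pos]
  exact ⟨0, by simp [codewords]⟩

theorem exp_lt_numCodewords {n l₁ l₂ : ℕ} {M₁ M₂ : ℕ →₀ ℕ} {G : TannerGraph n l₁ l₂ M₁ M₂}
    (hn : 0 < n) {t : ℝ} (h : t < rate G) :
    Real.exp (n * (t * Real.log 2)) < numCodewords G := by
  have hlog : 0 < Real.log 2 := Real.log_pos one_lt_two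
  have hnR : (0 : ℝ) < n := Nat.cast_pos.2 hn
  rw [rate, Real.logb, div_div, lt_div_iff₀ (by positivity)] at h
  rw [← Real.lt_log_iff_exp_lt (Nat.cast_pos.2 (numCodewords_pos G))]
  linarith

theorem probRateGT_mul_exp_le {n : ℕ} (hn : 0 < n) (l₁ l₂ : ℕ) (M₁ M₂ : ℕ →₀ ℕ) (t : ℝ) :
    probRateGT n l₁ l₂ M₁ M₂ t * Real.exp (n * (t * Real.log 2)) ≤
      expNumCodewords n l₁ l₂ M₁ M₂ := by
  classical
  rw [probRateGT, expNumCodewords, div_mul_eq_mul_div]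
  refine div_le_div_of_nonneg_right ?_ (Nat.cast_nonneg _)
  rw [← Finset.coe_filter_univ, Set.ncard_coe_finset, ← nsmul_eq_mul]
  calc #{G : TannerGraph n l₁ l₂ M₁ M₂ | t < rate G} • Real.exp (n * (t * Real.log 2))
      ≤ ∑ G : TannerGraph n l₁ l₂ M₁ M₂ with t < rate G, (numCodewords G : ℝ) :=
        Finset.card_nsmul_le_sum _ _ _ fun G hG =>
          (exp_lt_numCodewords hn (Finset.mem_filter.1 hG).2).le
    _ ≤ ∑ G : TannerGraph n l₁ l₂ M₁ M₂, (numCodewords G : ℝ) :=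
        Finset.sum_le_univ_sum_of_nonneg fun _ => Nat.cast_nonneg _

theorem tendsto_probRateGT_of_growthLE {l₁ l₂ : ℕ} {n : ℕ → ℕ} {M₁ M₂ : ℕ → ℕ →₀ ℕ}
    (hn : Tendsto n atTop atTop) {A t : ℝ}
    (h : GrowthLE n (fun k => expNumCodewords (n k) l₁ l₂ (M₁ k) (M₂ k)) A)
    (ht : A < t * Real.log 2) :
    Tendsto (fun k => probRateGT (n k) l₁ l₂ (M₁ k) (M₂ k) t) atTop (𝓝 0) := by
  obtain ⟨b, hAb, hbt⟩ := exists_between ht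
  have hnR : Tendsto (fun k => (n k : ℝ)) atTop atTop := tendsto_natCast_atTop_atTop.comp hn
  have hexp : Tendsto (fun k => Real.exp (-(n k * (t * Real.log 2 - b)))) atTop (𝓝 0) :=
    Real.tendsto_exp_neg_atTop_nhds_zero.comp (hnR.atTop_mul_const (sub_pos.2 hbt))
  refine squeeze_zero' (Eventually.of_forall fun k => ?_) ?_ hexp
  · rw [probRateGT]
    positivity
  · filter_upwards [h b hAb, hn.eventually_gt_atTop 0] with k hk hpos
    rw [← mul_le_mul_iff_left₀ (Real.exp_pos (n k * (t * Real.log 2))), ← Real.exp_add]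
    refine ((probRateGT_mul_exp_le hpos _ _ _ _ t).trans hk).trans_eq ?_
    ring_nf

end Concentration

/-! ### The function `θ` -/

section Theta

variable {l₁ l₂ : ℕ} {Γ Γ₁ Γ₂ : ℝ[X]}

theorem sum_logb_q (Γ : ℝ[X]) (v : ℝ) :
    (Γ.sum fun r g => g * Real.logb 2 (q r v)) = meanLogQ Γ v / Real.log 2 := by
  simp only [meanLogQ, Polynomial.sum, Real.logb, mul_div_assoc, Finset.sum_div]

theorem theta_eq (l₁ l₂ : ℕ) (Γ₁ Γ₂ : ℝ[X]) (e : ℝ) :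
    theta l₁ l₂ Γ₁ Γ₂ e =
      saddleExponent l₁ l₂ Γ₁ Γ₂ e / Real.log 2 - designRate l₁ l₂ Γ₁ Γ₂ := by
  rw [theta, saddleExponent, exponent, checkExponent, checkExponent, sum_logb_q, sum_logb_q,
    binEntropy₂_eq_div, Real.logb, Real.logb]
  ring

theorem theta_le_iff {e s : ℝ} :
    theta l₁ l₂ Γ₁ Γ₂ e ≤ s ↔
      saddleExponent l₁ l₂ Γ₁ Γ₂ e ≤ (s + designRate l₁ l₂ Γ₁ Γ₂) * Real.log 2 := by
  rw [theta_eq, sub_le_iff_le_add, div_le_iff₀ (Real.log_pos one_lt_two)]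

theorem IsProperDegreeDist.checkExponent_saddleRoot_le_one (hΓ : IsProperDegreeDist Γ) (l : ℕ)
    {e : ℝ} (he : e ∈ Ioo 0 (maxFraction Γ)) :
    checkExponent l Γ e (saddleRoot Γ e) ≤ l / avgDegree Γ * meanLogQ Γ 1 := by
  obtain ⟨hv, hroot⟩ := hΓ.saddleRoot_spec he
  have h := hΓ.checkExponent_saddle_le l one_pos hv
  rwa [hroot, checkExponent_one] at h

theorem saddleExponent_le (h₁ : IsProperDegreeDist Γ₁) (h₂ : IsProperDegreeDist Γ₂) (l₁ l₂ : ℕ)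
    {e : ℝ} (he : e ∈ thetaDomain Γ₁ Γ₂) :
    saddleExponent l₁ l₂ Γ₁ Γ₂ e ≤
      Real.log 2 + l₁ / avgDegree Γ₁ * meanLogQ Γ₁ 1 + l₂ / avgDegree Γ₂ * meanLogQ Γ₂ 1 := by
  have hH := Real.binEntropy_nonneg he.1.1.le he.1.2.le
  have hcoeff : (1 - l₁ - l₂ : ℝ) ≤ 1 := by
    linarith [(Nat.cast_nonneg l₁ : (0 : ℝ) ≤ l₁), (Nat.cast_nonneg l₂ : (0 : ℝ) ≤ l₂)]
  rw [saddleExponent, exponent]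
  refine add_le_add (add_le_add ?_ ?_) ?_
  · exact (mul_le_of_le_one_left hH hcoeff).trans Real.binEntropy_le_log_two
  · exact h₁.checkExponent_saddleRoot_le_one l₁ (h₁.exists_saddle_eq_iff.1 he.2.1)
  · exact h₂.checkExponent_saddleRoot_le_one l₂ (h₂.exists_saddle_eq_iff.1 he.2.2)

theorem bddAbove_theta (h₁ : IsProperDegreeDist Γ₁) (h₂ : IsProperDegreeDist Γ₂) (l₁ l₂ : ℕ) :
    BddAbove (theta l₁ l₂ Γ₁ Γ₂ '' thetaDomain Γ₁ Γ₂) := by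
  obtain ⟨B, hB⟩ : ∃ B, ∀ e ∈ thetaDomain Γ₁ Γ₂, saddleExponent l₁ l₂ Γ₁ Γ₂ e ≤ B :=
    ⟨_, fun e he => saddleExponent_le h₁ h₂ l₁ l₂ he⟩
  refine ⟨B / Real.log 2 - designRate l₁ l₂ Γ₁ Γ₂, forall_mem_image.2 fun e he => ?_⟩
  rw [theta_eq]
  have := hB e he
  gcongr

theorem nonempty_thetaDomain (h₁ : IsProperDegreeDist Γ₁) (h₂ : IsProperDegreeDist Γ₂) :
    (thetaDomain Γ₁ Γ₂).Nonempty := by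
  rw [thetaDomain_eq h₁ h₂, nonempty_Ioo]
  exact lt_min h₁.maxFraction_pos h₂.maxFraction_pos

theorem isLUB_saddleExponent {s : ℝ} (hs : IsLUB (theta l₁ l₂ Γ₁ Γ₂ '' thetaDomain Γ₁ Γ₂) s) :
    IsLUB (saddleExponent l₁ l₂ Γ₁ Γ₂ '' thetaDomain Γ₁ Γ₂)
      ((s + designRate l₁ l₂ Γ₁ Γ₂) * Real.log 2) := by
  have hlog : 0 < Real.log 2 := Real.log_pos one_lt_two
  refine ⟨forall_mem_image.2 fun e he => theta_le_iff.1 (hs.1 (mem_image_of_mem _ he)),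
    fun b hb => ?_⟩
  rw [← le_div_iff₀ hlog, ← le_sub_iff_add_le]
  refine hs.2 (forall_mem_image.2 fun e he => theta_le_iff.2 ?_)
  rw [sub_add_cancel, div_mul_cancel₀ _ hlog.ne']
  exact hb (mem_image_of_mem _ he)

section Limits

variable {n : ℕ → ℕ} {M₁ M₂ : ℕ → ℕ →₀ ℕ} {s t : ℝ}

theorem tendsto_logb_expNumCodewords_div (h₁ : IsProperDegreeDist Γ₁)
    (h₂ : IsProperDegreeDist Γ₂) (hl₁ : 0 < l₁) (hl₂ : 0 < l₂) (hn : Tendsto n atTop atTop)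
    (hM₁ : FollowsDegreeDist l₁ Γ₁ n M₁) (hM₂ : FollowsDegreeDist l₂ Γ₂ n M₂)
    (hs : IsLUB (theta l₁ l₂ Γ₁ Γ₂ '' thetaDomain Γ₁ Γ₂) s) :
    Tendsto (fun k => Real.logb 2 (expNumCodewords (n k) l₁ l₂ (M₁ k) (M₂ k)) / n k) atTop
      (𝓝 (s + designRate l₁ l₂ Γ₁ Γ₂)) := by
  have hlim := (tendsto_log_expNumCodewords_div h₁ h₂ hl₁ hl₂ hn hM₁ hM₂
    (isLUB_saddleExponent hs)).div_const (Real.log 2)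
  rw [mul_div_cancel_right₀ _ (Real.log_pos one_lt_two).ne'] at hlim
  simpa only [Real.logb, div_right_comm] using hlim

theorem tendsto_probRateGT_of_theta_le (h₁ : IsProperDegreeDist Γ₁)
    (h₂ : IsProperDegreeDist Γ₂) (hl₁ : 0 < l₁) (hl₂ : 0 < l₂) (hn : Tendsto n atTop atTop)
    (hM₁ : FollowsDegreeDist l₁ Γ₁ n M₁) (hM₂ : FollowsDegreeDist l₂ Γ₂ n M₂)
    (hs : ∀ e ∈ thetaDomain Γ₁ Γ₂, theta l₁ l₂ Γ₁ Γ₂ e ≤ s)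
    (ht : s + designRate l₁ l₂ Γ₁ Γ₂ < t) :
    Tendsto (fun k => probRateGT (n k) l₁ l₂ (M₁ k) (M₂ k) t) atTop (𝓝 0) :=
  tendsto_probRateGT_of_growthLE hn (growthLE_expNumCodewords h₁ h₂ hl₁ hl₂ hn hM₁ hM₂
    fun e he => theta_le_iff.1 (hs e he))
    (mul_lt_mul_of_pos_right ht (Real.log_pos one_lt_two))

end Limits

theorem q_one {r : ℕ} (hr : r ≠ 0) : q r 1 = 2 ^ (r - 1) := by
  obtain ⟨m, rfl⟩ := Nat.exists_eq_succ_of_ne_zero hr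
  rw [q, sub_self, zero_pow hr, one_add_one_eq_two, add_zero, pow_succ,
    mul_div_cancel_right₀ _ two_ne_zero]
  rfl

theorem meanDegree_evenPoly_one {r : ℕ} (hr : r ≠ 1) : meanDegree (evenPoly r) 1 = r / 2 := by
  obtain rfl | hr0 := eq_or_ne r 0
  · simp [meanDegree_evenPoly]
  obtain ⟨m, rfl⟩ := Nat.exists_eq_add_of_le' (show 2 ≤ r by lia)
  rw [meanDegree_evenPoly, sub_self, zero_pow hr0, zero_pow (by lia), one_add_one_eq_two,
    show m + 2 - 1 = m + 1 from rfl, pow_succ 2 (m + 1)]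
  field_simp
  ring

theorem IsProperDegreeDist.saddle_one (hΓ : IsProperDegreeDist Γ) (h : Γ.coeff 1 = 0) :
    saddle Γ 1 = 1 / 2 := by
  rw [saddle_eq_sum, div_eq_iff hΓ.avgDegree_pos.ne', avgDegree_eq_sum, Polynomial.sum,
    Polynomial.sum, Finset.mul_sum]
  refine Finset.sum_congr rfl fun r hr => ?_
  rw [meanDegree_evenPoly_one (ne_of_mem_of_not_mem hr (Polynomial.notMem_support_iff.2 h))]
  ring

theorem IsProperDegreeDist.saddleRoot_half (hΓ : IsProperDegreeDist Γ) (h : Γ.coeff 1 = 0) :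
    saddleRoot Γ (1 / 2) = 1 := by
  rw [← hΓ.saddle_one h, hΓ.saddleRoot_saddle one_pos]

theorem IsDegreeDist.meanLogQ_one (hΓ : IsDegreeDist Γ) (h : Γ.coeff 0 = 0) :
    meanLogQ Γ 1 = (avgDegree Γ - 1) * Real.log 2 := by
  have hsum : ∑ r ∈ Γ.support, Γ.coeff r = 1 := by
    simpa only [Polynomial.eval_eq_sum, Polynomial.sum, one_pow, mul_one] using hΓ.sum_eq_one
  nth_rw 2 [← hsum]
  rw [avgDegree_eq_sum, meanLogQ, Polynomial.sum, Polynomial.sum, ← Finset.sum_sub_distrib,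
    Finset.sum_mul]
  refine Finset.sum_congr rfl fun r hr => ?_
  have hr0 : r ≠ 0 := ne_of_mem_of_not_mem hr (Polynomial.notMem_support_iff.2 h)
  rw [q_one hr0, Real.log_pow, Nat.cast_pred (Nat.pos_of_ne_zero hr0)]
  ring

theorem half_mem_thetaDomain (h₁ : IsProperDegreeDist Γ₁) (h₂ : IsProperDegreeDist Γ₂)
    (hc₁ : Γ₁.coeff 1 = 0) (hc₂ : Γ₂.coeff 1 = 0) : 1 / 2 ∈ thetaDomain Γ₁ Γ₂ :=
  ⟨by norm_num, ⟨1, one_pos, h₁.saddle_one hc₁⟩, 1, one_pos, h₂.saddle_one hc₂⟩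

theorem theta_half (h₁ : IsProperDegreeDist Γ₁) (h₂ : IsProperDegreeDist Γ₂)
    (hc₁ : ∀ r < 2, Γ₁.coeff r = 0) (hc₂ : ∀ r < 2, Γ₂.coeff r = 0) (l₁ l₂ : ℕ) :
    theta l₁ l₂ Γ₁ Γ₂ (1 / 2) = 0 := by
  have hpos₁ := h₁.avgDegree_pos
  have hpos₂ := h₂.avgDegree_pos
  rw [theta_eq, saddleExponent, h₁.saddleRoot_half (hc₁ 1 one_lt_two),
    h₂.saddleRoot_half (hc₂ 1 one_lt_two), exponent, checkExponent_one, checkExponent_one,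
    h₁.meanLogQ_one (hc₁ 0 two_pos), h₂.meanLogQ_one (hc₂ 0 two_pos), one_div,
    Real.binEntropy_two_inv, designRate]
  field_simp
  ring

theorem csSup_theta_eq_zero_iff (h₁ : IsProperDegreeDist Γ₁) (h₂ : IsProperDegreeDist Γ₂)
    (hc₁ : ∀ r < 2, Γ₁.coeff r = 0) (hc₂ : ∀ r < 2, Γ₂.coeff r = 0) (l₁ l₂ : ℕ) :
    sSup (theta l₁ l₂ Γ₁ Γ₂ '' thetaDomain Γ₁ Γ₂) = 0 ↔
      ∀ e ∈ thetaDomain Γ₁ Γ₂, theta l₁ l₂ Γ₁ Γ₂ e ≤ theta l₁ l₂ Γ₁ Γ₂ (1 / 2) := by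
  have hhalf := theta_half h₁ h₂ hc₁ hc₂ l₁ l₂
  have hmem : 0 ∈ theta l₁ l₂ Γ₁ Γ₂ '' thetaDomain Γ₁ Γ₂ :=
    ⟨_, half_mem_thetaDomain h₁ h₂ (hc₁ 1 one_lt_two) (hc₂ 1 one_lt_two), hhalf⟩
  have hle := le_csSup (bddAbove_theta h₁ h₂ l₁ l₂) hmem
  rw [hhalf, ← forall_mem_image (p := (· ≤ 0)), ← hle.ge_iff_eq',
    csSup_le_iff (bddAbove_theta h₁ h₂ l₁ l₂) ⟨0, hmem⟩]

end Theta

end TwoEdgeLDPC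

theorem mainTheorem8 (l₁ l₂ : ℕ) (hl₁ : 1 ≤ l₁) (hl₂ : 1 ≤ l₂) (Γ₁ Γ₂ : ℝ[X])
    (hΓ₁ : IsDegreeDist Γ₁) (hΓ₂ : IsDegreeDist Γ₂)
    (hdeg₁ : ∃ r, 2 ≤ r ∧ Γ₁.coeff r ≠ 0) (hdeg₂ : ∃ r, 2 ≤ r ∧ Γ₂.coeff r ≠ 0) :
    -- existence, uniqueness and range of the saddle point solutions `v₁`, `v₂`
    (∀ e ∈ Ioo 0 (maxFraction Γ₁), ∃! v : ℝ, 0 < v ∧ saddle Γ₁ v = e) ∧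
    (∀ e ∈ Ioo 0 (maxFraction Γ₂), ∃! v : ℝ, 0 < v ∧ saddle Γ₂ v = e) ∧
    thetaDomain Γ₁ Γ₂ = Ioo 0 (min (maxFraction Γ₁) (maxFraction Γ₂)) ∧
    -- the supremum of `θ` is taken over a nonempty bounded set of reals
    (theta l₁ l₂ Γ₁ Γ₂ '' thetaDomain Γ₁ Γ₂).Nonempty ∧
    BddAbove (theta l₁ l₂ Γ₁ Γ₂ '' thetaDomain Γ₁ Γ₂) ∧
    -- growth rate of `𝔼[N]`, and concentration of the rate
    (∀ (n : ℕ → ℕ) (M₁ M₂ : ℕ → ℕ →₀ ℕ), Tendsto n atTop atTop →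
      FollowsDegreeDist l₁ Γ₁ n M₁ → FollowsDegreeDist l₂ Γ₂ n M₂ →
      Tendsto (fun k => Real.logb 2 (expNumCodewords (n k) l₁ l₂ (M₁ k) (M₂ k)) / n k) atTop
        (𝓝 (sSup (theta l₁ l₂ Γ₁ Γ₂ '' thetaDomain Γ₁ Γ₂) + designRate l₁ l₂ Γ₁ Γ₂)) ∧
      (sSup (theta l₁ l₂ Γ₁ Γ₂ '' thetaDomain Γ₁ Γ₂) = 0 → ∀ δ : ℝ, 0 < δ →
        Tendsto (fun k => probRateGT (n k) l₁ l₂ (M₁ k) (M₂ k) (designRate l₁ l₂ Γ₁ Γ₂ + δ)) atTop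
          (𝓝 0))) ∧
    -- reformulation of the condition `sup θ = 0`
    ((∀ r < 2, Γ₁.coeff r = 0 ∧ Γ₂.coeff r = 0) →
      (1 / 2 : ℝ) ∈ thetaDomain Γ₁ Γ₂ ∧
      (sSup (theta l₁ l₂ Γ₁ Γ₂ '' thetaDomain Γ₁ Γ₂) = 0 ↔
        ∀ e ∈ thetaDomain Γ₁ Γ₂, theta l₁ l₂ Γ₁ Γ₂ e ≤ theta l₁ l₂ Γ₁ Γ₂ (1 / 2))) := by
  have h₁ : IsProperDegreeDist Γ₁ := ⟨hΓ₁, hdeg₁⟩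
  have h₂ : IsProperDegreeDist Γ₂ := ⟨hΓ₂, hdeg₂⟩
  have hne := (nonempty_thetaDomain h₁ h₂).image (theta l₁ l₂ Γ₁ Γ₂)
  have hbdd := bddAbove_theta h₁ h₂ l₁ l₂
  have hlub := isLUB_csSup hne hbdd
  refine ⟨fun _ => h₁.existsUnique_saddle_eq, fun _ => h₂.existsUnique_saddle_eq,
    thetaDomain_eq h₁ h₂, hne, hbdd, fun n M₁ M₂ hn hM₁ hM₂ => ⟨?_, fun hsup δ hδ => ?_⟩,
    fun hc => ⟨?_, ?_⟩⟩
  · exact tendsto_logb_expNumCodewords_div h₁ h₂ hl₁ hl₂ hn hM₁ hM₂ hlub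
  · have hle : ∀ e ∈ thetaDomain Γ₁ Γ₂, theta l₁ l₂ Γ₁ Γ₂ e ≤ 0 := fun e he =>
      hsup ▸ hlub.1 (mem_image_of_mem _ he)
    exact tendsto_probRateGT_of_theta_le h₁ h₂ hl₁ hl₂ hn hM₁ hM₂ hle (by linarith)
  · exact half_mem_thetaDomain h₁ h₂ (hc 1 one_lt_two).1 (hc 1 one_lt_two).2
  · exact csSup_theta_eq_zero_iff h₁ h₂ (fun r hr => (hc r hr).1) (fun r hr => (hc r hr).2) l₁ l₂
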